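/- Let $d$ be a dimension. There is a constant $C_d>0$, depending only on $d$, such that the following holds. Let $\mathcal M$ be a von Neumann algebra with a normal semifinite faithful trace $\tau$, let $\mathcal N=L_\infty(\mathbb R^d)\,\overline\otimes\,\mathcal M$ carry the tensor trace $\varphi=\int_{\mathbb R^d}\otimes\,\tau$, and identify $L_2(\mathcal N)=L_2(\mathbb R^d;L_2(\mathcal M,\tau))$. For $k\in\mathbb Z$ let $\mathcal Q_k$ be the set of standard dyadic cubes $\prod_i[m_i2^{-k},(m_i+1)2^{-k})$, $m\in\mathbb Z^d$; for $Q\in\mathcal Q_k$ let $5Q$ be the cube with the same center and five times the side length. For $h\in L_2(\mathcal N)$ let $\mathsf E_kh(x)$ be the average of $h$ over the cube of $\mathcal Q_k$ containing $x$, let $M_kh(x)$ be the average of $h$ over the open Euclidean ball of center $x$ and radius $2^{-k}$, and put $dh_k=\mathsf E_kh-\mathsf E_{k-1}h$. Let $\mathcal N_k=\mathsf E_k(\mathcal N)$ be the von Neumann subalgebra of the elements of $\mathcal N$ that are constant on each cube of $\mathcal Q_k$. Let $(\varepsilon_k)_{k\in\mathbb Z}$ be a sequence of independent random variables on a probability space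 $(\Omega,P)$, each taking the values $\pm1$ with probability $\tfrac12$, and, for a finite set $F\subset\mathbb Z$, put $$Th=\sum_{k\in F}\varepsilon_k\,(M_k-\mathsf E_k)h .$$ Let $h\in L_2(\mathcal N)$ and let $s\ge1$ be an integer. For every $k\in\mathbb Z$ let $A_k$ and $B_k$ be projections in $\mathcal N_k$ such that $$A_k^{\perp}\,dh_{k+s}=0\qquad\text{and}\qquad dh_{k+s}\,B_k^{\perp}=0 ,$$ where $p^\perp=1-p$. Write $A_k=\bigvee_{Q\in\mathcal Q_k}A_Q\mathbf 1_Q$ and $B_k=\bigvee_{Q\in\mathcal Q_k}B_Q\mathbf 1_Q$ with projections $A_Q,B_Q\in\mathcal M$, and put $$5A_k=\bigvee_{Q\in\mathcal Q_k}A_Q\mathbf 1_{5Q},\quad 5B_k=\bigvee_{Q\in\mathcal Q_k}B_Q\mathbf 1_{5Q},\quad A_{h,s}=\bigvee_{k\in\mathbb Z}5A_k,\quad B_{h,s}=\bigvee_{k\in\mathbb Z}5B_k .$$ Then $$\|A_{h,s}^{\perp}\,Th\|_{L_2(L_\infty(\Omega)\overline\otimes\mathcal N)}\le C_d\,2^{-s/2}\|h\|_2\qquad\text{and}\qquad\|(Th)\,B_{h,s}^{\perp}\|_{L_2(L_\infty(\Omega)\overline\otimes\mathcal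 N)}\le C_d\,2^{-s/2}\|h\|_2 .$$ In particular $C_d$ does not depend on $F$, $s$, $h$, $\mathcal M$, $\tau$, the projections, or the choice of $(\Omega,P)$ and $(\varepsilon_k)$. -/

import Mathlib

open MeasureTheory ProbabilityTheory
open scoped ENNReal NNReal ComplexConjugate

universe u v

noncomputable section

namespace PseudoLoc

/-! ## Normal semifinite faithful traces -/

/-- A normal semifinite faithful trace `τ : M₊ → [0, ∞]` on a von Neumann algebra `M`.
Only the values of `toFun` on positive elements are meaningful. -/
structure NSFTrace (M : Type u) [CStarAlgebra M] [PartialOrder M] [StarOrderedRing M] where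
  toFun : M → ℝ≥0∞
  map_add' : ∀ x y : M, 0 ≤ x → 0 ≤ y → toFun (x + y) = toFun x + toFun y
  map_smul' : ∀ (c : ℝ≥0) (x : M), 0 ≤ x → toFun (((c : ℝ) : ℂ) • x) = c * toFun x
  trace' : ∀ x : M, toFun (star x * x) = toFun (x * star x)
  /-- `τ (sup xᵢ) = sup τ xᵢ` for increasing nets of positive elements with a supremum in `M`. -/
  normal' : ∀ (D : Set M) (x : M), D.Nonempty → (∀ y ∈ D, 0 ≤ y) → DirectedOn (· ≤ ·) D →
    IsLUB D x → IsLUB (toFun '' D) (toFun x)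
  faithful' : ∀ x : M, 0 ≤ x → toFun x = 0 → x = 0
  semifinite' : ∀ x : M, 0 ≤ x → x ≠ 0 → ∃ y : M, 0 ≤ y ∧ y ≤ x ∧ y ≠ 0 ∧ toFun y < ∞

variable {M : Type u} [CStarAlgebra M] [PartialOrder M] [StarOrderedRing M]

namespace NSFTrace

theorem mono (τ : NSFTrace M) {x y : M} (hx : 0 ≤ x) (hxy : x ≤ y) : τ.toFun x ≤ τ.toFun y := by
  have h := τ.map_add' x (y - x) hx (sub_nonneg.2 hxy)
  rw [add_sub_cancel] at h
  rw [h]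
  exact le_self_add

theorem map_zero (τ : NSFTrace M) : τ.toFun 0 = 0 := by
  have h := τ.map_smul' 0 0 le_rfl
  simpa using h

/-- `τ (x^* x)`. -/
def sq (τ : NSFTrace M) (x : M) : ℝ≥0∞ := τ.toFun (star x * x)

theorem sq_star (τ : NSFTrace M) (x : M) : τ.sq (star x) = τ.sq x := by
  simp only [sq, star_star]
  exact (τ.trace' x).symm

theorem sq_smul (τ : NSFTrace M) (c : ℂ) (x : M) : τ.sq (c • x) = (‖c‖₊ ^ 2 : ℝ≥0) * τ.sq x := by
  have h : star (c • x) * (c • x) = ((((‖c‖₊ ^ 2 : ℝ≥0) : ℝ)) : ℂ) • (star x * x) := by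
    rw [star_smul, smul_mul_smul_comm]
    congr 1
    rw [mul_comm]
    simpa using Complex.mul_conj' c
  rw [sq, h, τ.map_smul' _ _ (star_mul_self_nonneg x), sq]

theorem sq_add_add_sq_sub (τ : NSFTrace M) (x y : M) :
    τ.sq (x + y) + τ.sq (x - y) = 2 * (τ.sq x + τ.sq y) := by
  have e : star (x + y) * (x + y) + star (x - y) * (x - y)
      = (star x * x + star x * x) + (star y * y + star y * y) := by
    simp only [star_add, star_sub]
    noncomm_ring
  have h := congrArg τ.toFun e
  have p := fun z : M => star_mul_self_nonneg z
  rw [τ.map_add' _ _ (p _) (p _), τ.map_add' _ _ (add_nonneg (p _) (p _)) (add_nonneg (p _) (p _)),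
    τ.map_add' _ _ (p _) (p _), τ.map_add' _ _ (p _) (p _)] at h
  simp only [sq]
  rw [h]
  ring

theorem sq_mul_le (τ : NSFTrace M) (a x : M) : τ.sq (a * x) ≤ (‖a‖₊ ^ 2 : ℝ≥0) * τ.sq x := by
  have h : star (a * x) * (a * x) ≤ ((((‖a‖₊ ^ 2 : ℝ≥0) : ℝ)) : ℂ) • (star x * x) := by
    have h1 : star x * (star a * a) * x ≤ ‖star a * a‖ • (star x * x) :=
      CStarAlgebra.star_left_conjugate_le_norm_smul (IsSelfAdjoint.star_mul_self a)
    rw [CStarRing.norm_star_mul_self] at h1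
    have h2 : star (a * x) * (a * x) = star x * (star a * a) * x := by
      simp only [star_mul, mul_assoc]
    rw [h2]
    refine h1.trans (le_of_eq ?_)
    rw [Complex.coe_smul]
    simp [pow_two]
  rw [sq, sq, ← τ.map_smul' _ _ (star_mul_self_nonneg x)]
  exact τ.mono (star_mul_self_nonneg _) h

/-- The left ideal `{x : τ (x^* x) < ∞}`. -/
def sqFinite (τ : NSFTrace M) : Submodule ℂ M where
  carrier := {x | τ.sq x < ∞}
  zero_mem' := by simp [sq, τ.map_zero]
  add_mem' := by
    intro x y hx hy
    refine lt_of_le_of_lt (le_self_add.trans (τ.sq_add_add_sq_sub x y).le) ?_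
    exact ENNReal.mul_lt_top (by simp) (ENNReal.add_lt_top.2 ⟨hx, hy⟩)
  smul_mem' := by
    intro c x hx
    simp only [Set.mem_ofPred_eq, τ.sq_smul]
    exact ENNReal.mul_lt_top (by simp) hx

end NSFTrace

/-! ## The Hilbert space `L₂(M, τ)` -/

/-- `{x ∈ M : τ (x^* x) < ∞}`, to be equipped with `‖x‖₂ = τ (x^* x) ^ (1/2)`. -/
def PreL2 (τ : NSFTrace M) : Type u := τ.sqFinite

namespace PreL2

variable (τ : NSFTrace M)

instance : AddCommGroup (PreL2 τ) := inferInstanceAs (AddCommGroup τ.sqFinite)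
instance : Module ℂ (PreL2 τ) := inferInstanceAs (Module ℂ τ.sqFinite)

/-- The underlying element of `M`. -/
def val : PreL2 τ →ₗ[ℂ] M := τ.sqFinite.subtype

/-- `‖x‖₂² = τ (x^* x)`. -/
def normSq (x : PreL2 τ) : ℝ := (τ.sq (val τ x)).toReal

variable {τ}

theorem sq_val_ne_top (x : PreL2 τ) : τ.sq (val τ x) ≠ ∞ := x.2.ne

theorem normSq_nonneg (x : PreL2 τ) : 0 ≤ normSq τ x := ENNReal.toReal_nonneg

theorem normSq_smul (c : ℂ) (x : PreL2 τ) : normSq τ (c • x) = ‖c‖ ^ 2 * normSq τ x := by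
  simp [normSq, map_smul, τ.sq_smul]

theorem parallelogram (x y : PreL2 τ) :
    normSq τ (x + y) + normSq τ (x - y) = 2 * (normSq τ x + normSq τ y) := by
  have h := congrArg ENNReal.toReal (τ.sq_add_add_sq_sub (val τ x) (val τ y))
  rw [← map_add, ← map_sub, ENNReal.toReal_add (sq_val_ne_top _) (sq_val_ne_top _),
    ENNReal.toReal_mul, ENNReal.toReal_add (sq_val_ne_top _) (sq_val_ne_top _)] at h
  simpa [normSq] using h

theorem normSq_add_le (x y : PreL2 τ) {c : ℝ} (hc : 0 < c) :
    normSq τ (x + y) ≤ (1 + c ^ 2) * normSq τ x + (1 + (c⁻¹) ^ 2) * normSq τ y := by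
  have e : star (val τ x + val τ y) * (val τ x + val τ y)
      + star ((c : ℂ) • val τ x - ((c⁻¹ : ℝ) : ℂ) • val τ y) *
        ((c : ℂ) • val τ x - ((c⁻¹ : ℝ) : ℂ) • val τ y)
      = (star (val τ x) * val τ x + star ((c : ℂ) • val τ x) * ((c : ℂ) • val τ x))
        + (star (val τ y) * val τ y
          + star (((c⁻¹ : ℝ) : ℂ) • val τ y) * (((c⁻¹ : ℝ) : ℂ) • val τ y)) := by
    have hc' : (c : ℂ) ≠ 0 := by exact_mod_cast hc.ne'
    simp only [star_add, star_sub, star_smul, add_mul, mul_add, sub_mul, mul_sub,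
      smul_mul_smul_comm, Complex.star_def, Complex.conj_ofReal, Complex.ofReal_inv]
    rw [map_inv₀, Complex.conj_ofReal, mul_inv_cancel₀ hc', inv_mul_cancel₀ hc']
    simp only [one_smul]
    abel
  have p := fun z : M => star_mul_self_nonneg z
  have h := congrArg τ.toFun e
  rw [τ.map_add' _ _ (p _) (p _), τ.map_add' _ _ (add_nonneg (p _) (p _)) (add_nonneg (p _) (p _)),
    τ.map_add' _ _ (p _) (p _), τ.map_add' _ _ (p _) (p _)] at h
  change τ.sq _ + τ.sq _ = (τ.sq _ + τ.sq _) + (τ.sq _ + τ.sq _) at h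
  simp only [← map_smul, ← map_add, ← map_sub] at h
  have h' := congrArg ENNReal.toReal h
  have ne := fun z : PreL2 τ => sq_val_ne_top z
  rw [ENNReal.toReal_add (ne _) (ne _),
    ENNReal.toReal_add (ENNReal.add_ne_top.2 ⟨ne _, ne _⟩) (ENNReal.add_ne_top.2 ⟨ne _, ne _⟩),
    ENNReal.toReal_add (ne _) (ne _), ENNReal.toReal_add (ne _) (ne _)] at h'
  change normSq τ _ + normSq τ _ = (normSq τ _ + normSq τ _) + (normSq τ _ + normSq τ _) at h'
  rw [normSq_smul, normSq_smul] at h'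
  have := normSq_nonneg ((c : ℂ) • x - ((c⁻¹ : ℝ) : ℂ) • y)
  simp only [Complex.norm_real, Real.norm_eq_abs, sq_abs] at h'
  linarith

theorem sqrt_normSq_add_le (x y : PreL2 τ) :
    Real.sqrt (normSq τ (x + y)) ≤ Real.sqrt (normSq τ x) + Real.sqrt (normSq τ y) := by
  set a := Real.sqrt (normSq τ x) with ha
  set b := Real.sqrt (normSq τ y) with hb
  have ha0 : 0 ≤ a := Real.sqrt_nonneg _
  have hb0 : 0 ≤ b := Real.sqrt_nonneg _
  have hA : normSq τ x = a ^ 2 := (Real.sq_sqrt (normSq_nonneg x)).symm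
  have hB : normSq τ y = b ^ 2 := (Real.sq_sqrt (normSq_nonneg y)).symm
  refine le_of_forall_pos_le_add fun ε hε => ?_
  have ha' : 0 < a + ε / 2 := by positivity
  have hb' : 0 < b + ε / 2 := by positivity
  have hc2 : 0 < (b + ε / 2) / (a + ε / 2) := by positivity
  have h := normSq_add_le x y (Real.sqrt_pos.2 hc2)
  rw [inv_pow, Real.sq_sqrt hc2.le, inv_div, hA, hB] at h
  refine Real.sqrt_le_iff.2 ⟨by positivity, h.trans ?_⟩
  have h1 : (1 + (b + ε / 2) / (a + ε / 2)) * a ^ 2 ≤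
      (1 + (b + ε / 2) / (a + ε / 2)) * (a + ε / 2) ^ 2 := by
    gcongr
    linarith
  have h2 : (1 + (a + ε / 2) / (b + ε / 2)) * b ^ 2 ≤
      (1 + (a + ε / 2) / (b + ε / 2)) * (b + ε / 2) ^ 2 := by
    gcongr
    linarith
  have h3 : (1 + (b + ε / 2) / (a + ε / 2)) * (a + ε / 2) ^ 2 +
      (1 + (a + ε / 2) / (b + ε / 2)) * (b + ε / 2) ^ 2 = (a + b + ε) ^ 2 := by
    field_simp
    ring
  linarith

instance : SeminormedAddCommGroup (PreL2 τ) :=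
  AddGroupSeminorm.toSeminormedAddCommGroup
    { toFun := fun x => Real.sqrt (normSq τ x)
      map_zero' := by simp [normSq, NSFTrace.sq, τ.map_zero]
      add_le' := sqrt_normSq_add_le
      neg' := fun x => by
        have h := normSq_smul (-1 : ℂ) x
        rw [neg_one_smul] at h
        simp [h] }

theorem norm_def (x : PreL2 τ) : ‖x‖ = Real.sqrt (normSq τ x) := rfl

theorem norm_sq (x : PreL2 τ) : ‖x‖ ^ 2 = (τ.sq (val τ x)).toReal :=
  Real.sq_sqrt (normSq_nonneg x)

instance : NormedSpace ℂ (PreL2 τ) where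
  norm_smul_le c x := by
    rw [norm_def, norm_def, normSq_smul, Real.sqrt_mul (by positivity),
      Real.sqrt_sq (norm_nonneg c)]

end PreL2

/-- The noncommutative `L₂(M, τ)`: the completion of `{x ∈ M : τ (x^* x) < ∞}` for
`‖x‖₂ = τ (x^* x) ^ (1/2)`. -/
abbrev L2 (τ : NSFTrace M) : Type u := UniformSpace.Completion (PreL2 τ)

/-- The Hilbert space structure of `L₂(M, τ)`, the inner product being given by polarization of
its norm. -/
instance (τ : NSFTrace M) : InnerProductSpace ℂ (L2 τ) :=
  InnerProductSpace.ofNorm (𝕜 := ℂ) (E := L2 τ) (by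
    intro x y
    refine UniformSpace.Completion.induction_on₂ x y
      (isClosed_eq (by fun_prop) (by fun_prop)) fun a b => ?_
    rw [← UniformSpace.Completion.coe_add, ← UniformSpace.Completion.coe_sub]
    simp only [UniformSpace.Completion.norm_coe, ← pow_two, PreL2.norm_sq]
    exact PreL2.parallelogram a b)

/-- Left multiplication `x ↦ a x` by `a ∈ M` on `{x ∈ M : τ (x^* x) < ∞}`. -/
def preLmul (τ : NSFTrace M) (a : M) : PreL2 τ →L[ℂ] PreL2 τ :=
  LinearMap.mkContinuous
    (LinearMap.codRestrict τ.sqFinite ((LinearMap.mulLeft ℂ a).comp (PreL2.val τ)) (fun x =>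
      lt_of_le_of_lt (τ.sq_mul_le a _) (ENNReal.mul_lt_top (by simp) x.2)) :
      PreL2 τ →ₗ[ℂ] PreL2 τ) ‖a‖ (fun x => by
    refine le_of_sq_le_sq ?_ (by positivity)
    rw [mul_pow, PreL2.norm_sq, PreL2.norm_sq]
    have h := ENNReal.toReal_mono (ENNReal.mul_ne_top (by simp) (PreL2.sq_val_ne_top x))
      (τ.sq_mul_le a (PreL2.val τ x))
    rw [ENNReal.toReal_mul] at h
    exact h)

theorem val_preLmul (τ : NSFTrace M) (a : M) (x : PreL2 τ) :
    PreL2.val τ (preLmul τ a x) = a * PreL2.val τ x := rfl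

/-- Left multiplication by `a ∈ M` on `L₂(M, τ)`. -/
def lmul (τ : NSFTrace M) (a : M) : L2 τ →L[ℂ] L2 τ := (preLmul τ a).completion

/-- The involution `x ↦ x^*` on `{x ∈ M : τ (x^* x) < ∞}`. -/
def preStar (τ : NSFTrace M) : PreL2 τ →L⋆[ℂ] PreL2 τ :=
  LinearMap.mkContinuous
    ({ toFun := fun x => (⟨star (PreL2.val τ x), by
          change τ.sq _ < ∞
          rw [τ.sq_star]
          exact x.2⟩ : τ.sqFinite)
       map_add' := fun x y => Subtype.ext (by simp; rfl)
       map_smul' := fun c x => Subtype.ext (by simp; rfl) } :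
      PreL2 τ →ₗ⋆[ℂ] PreL2 τ) 1 (fun x => by
    refine le_of_eq ?_
    rw [one_mul, PreL2.norm_def, PreL2.norm_def]
    exact congrArg (fun t : ℝ≥0∞ => Real.sqrt t.toReal) (τ.sq_star (PreL2.val τ x)))

/-- The involution `x ↦ x^*` of `L₂(M, τ)`, a conjugate linear isometry. -/
def starL2 (τ : NSFTrace M) : L2 τ →L⋆[ℂ] L2 τ := (preStar τ).completion

/-! ## Square integrability of averages -/

theorem memLp_average {α E : Type*} [MeasurableSpace α] [NormedAddCommGroup E] [NormedSpace ℝ E]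
    {μ : Measure α} [SFinite μ] {S : α → Set α} (hS : MeasurableSet {p : α × α | p.2 ∈ S p.1})
    (hsymm : ∀ x y, y ∈ S x ↔ x ∈ S y) {v : ℝ≥0∞} (hv : ∀ x, μ (S x) = v) (hv_top : v ≠ ∞)
    {f : α → E} (hf : MemLp f 2 μ) : MemLp (fun x => ⨍ y in S x, f y ∂μ) 2 μ := by
  have hSx : ∀ x, MeasurableSet (S x) := fun x => measurable_prodMk_left hS
  have e : (fun x => ⨍ y in S x, f y ∂μ) = fun x => v.toReal⁻¹ • ∫ y, (S x).indicator f y ∂μ := by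
    funext x
    rw [setAverage_eq, integral_indicator (hSx x), measureReal_def, hv]
  rw [e]
  refine MemLp.const_smul (c := v.toReal⁻¹) (f := fun x => ∫ y, (S x).indicator f y ∂μ) ?_
  have hm : AEStronglyMeasurable (fun p : α × α => (S p.1).indicator f p.2) (μ.prod μ) :=
    (hf.1.comp_snd (μ := μ)).indicator hS
  refine ⟨hm.integral_prod_right', ?_⟩
  rw [eLpNorm_lt_top_iff_lintegral_rpow_enorm_lt_top (by norm_num) (by norm_num)]
  have hfe : AEMeasurable (fun y => ‖f y‖ₑ) μ := hf.1.enorm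
  have key : ∀ x, ‖∫ y, (S x).indicator f y ∂μ‖ₑ ^ (2 : ℝ≥0∞).toReal ≤
      v * ∫⁻ y, (S x).indicator (fun y => ‖f y‖ₑ ^ (2 : ℝ)) y ∂μ := by
    intro x
    have h1 : ‖∫ y, (S x).indicator f y ∂μ‖ₑ ≤ ∫⁻ y in S x, ‖f y‖ₑ ∂μ := by
      rw [integral_indicator (hSx x)]
      exact enorm_integral_le_lintegral_enorm _
    have h2 := ENNReal.lintegral_mul_le_Lp_mul_Lq (μ.restrict (S x))
      (Real.HolderConjugate.two_two) hfe.restrict (aemeasurable_const (b := (1 : ℝ≥0∞)))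
    simp only [Pi.mul_apply, mul_one, ENNReal.one_rpow, lintegral_const, one_mul,
      Measure.restrict_apply_univ, hv] at h2
    calc ‖∫ y, (S x).indicator f y ∂μ‖ₑ ^ (2 : ℝ≥0∞).toReal
        ≤ ((∫⁻ y in S x, ‖f y‖ₑ ^ (2 : ℝ) ∂μ) ^ (1 / 2 : ℝ) * v ^ (1 / 2 : ℝ)) ^ (2 : ℝ) := by
          rw [ENNReal.toReal_ofNat]
          exact ENNReal.rpow_le_rpow (h1.trans h2) (by norm_num)
      _ = v * ∫⁻ y, (S x).indicator (fun y => ‖f y‖ₑ ^ (2 : ℝ)) y ∂μ := by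
          rw [lintegral_indicator (hSx x), ENNReal.mul_rpow_of_nonneg _ _ (by norm_num),
            ← ENNReal.rpow_mul, ← ENNReal.rpow_mul]
          norm_num
          rw [mul_comm]
  have hfin : ∫⁻ y, ‖f y‖ₑ ^ (2 : ℝ) ∂μ < ∞ := by
    have := (eLpNorm_lt_top_iff_lintegral_rpow_enorm_lt_top (p := 2) (by norm_num)
      (by norm_num)).1 hf.2
    simpa using this
  have hm2 : AEMeasurable (Function.uncurry fun x y =>
      (S x).indicator (fun y => ‖f y‖ₑ ^ (2 : ℝ)) y) (μ.prod μ) :=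
    ((hf.1.comp_snd (μ := μ)).enorm.pow_const (2 : ℝ)).indicator hS
  calc ∫⁻ x, ‖∫ y, (S x).indicator f y ∂μ‖ₑ ^ (2 : ℝ≥0∞).toReal ∂μ
      ≤ ∫⁻ x, v * ∫⁻ y, (S x).indicator (fun y => ‖f y‖ₑ ^ (2 : ℝ)) y ∂μ ∂μ :=
        lintegral_mono key
    _ = v * ∫⁻ x, ∫⁻ y, (S x).indicator (fun y => ‖f y‖ₑ ^ (2 : ℝ)) y ∂μ ∂μ :=
        lintegral_const_mul' _ _ hv_top
    _ = v * ∫⁻ y, ∫⁻ x, (S x).indicator (fun y => ‖f y‖ₑ ^ (2 : ℝ)) y ∂μ ∂μ := by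
        rw [lintegral_lintegral_swap hm2]
    _ = v * ∫⁻ y, v * ‖f y‖ₑ ^ (2 : ℝ) ∂μ := by
        congr 1
        refine lintegral_congr fun y => ?_
        have : (fun x => (S x).indicator (fun y => ‖f y‖ₑ ^ (2 : ℝ)) y) =
            (S y).indicator (fun _ => ‖f y‖ₑ ^ (2 : ℝ)) := by
          funext x
          by_cases h : y ∈ S x
          · rw [Set.indicator_of_mem h, Set.indicator_of_mem ((hsymm x y).1 h)]
          · rw [Set.indicator_of_notMem h, Set.indicator_of_notMem (fun h' => h ((hsymm x y).2 h'))]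
        rw [this, lintegral_indicator (hSx y), lintegral_const, Measure.restrict_apply_univ, hv,
          mul_comm]
    _ < ∞ := by
        rw [lintegral_const_mul' _ _ hv_top]
        exact ENNReal.mul_lt_top hv_top.lt_top (ENNReal.mul_lt_top hv_top.lt_top hfin)

/-! ## Dyadic cubes -/

/-- `ℝᵈ` with its Euclidean norm. -/
abbrev Rd (d : ℕ) : Type := EuclideanSpace ℝ (Fin d)

/-- With `r = 1`: the standard dyadic cube `∏ᵢ [mᵢ 2⁻ᵏ, (mᵢ + 1) 2⁻ᵏ)` of side length `2⁻ᵏ`;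
in general the cube with the same center and with side length `r 2⁻ᵏ`. -/
def cube {d : ℕ} (r : ℝ) (k : ℤ) (m : Fin d → ℤ) : Set (Rd d) :=
  {x | ∀ i, ((m i : ℝ) + 1 / 2 - r / 2) * (2 : ℝ) ^ (-k) ≤ x i ∧
    x i < ((m i : ℝ) + 1 / 2 + r / 2) * (2 : ℝ) ^ (-k)}

/-- The index `m` of the dyadic cube of side length `2⁻ᵏ` that contains `x`. -/
def cubeIdx {d : ℕ} (k : ℤ) (x : Rd d) : Fin d → ℤ := fun i => ⌊x i * (2 : ℝ) ^ k⌋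

theorem mem_cube_one {d : ℕ} (k : ℤ) (m : Fin d → ℤ) (x : Rd d) :
    x ∈ cube 1 k m ↔ cubeIdx k x = m := by
  have hk : (0 : ℝ) < 2 ^ k := by positivity
  rw [funext_iff]
  refine forall_congr' fun i => ?_
  rw [cubeIdx, Int.floor_eq_iff, zpow_neg, ← div_eq_mul_inv, ← div_eq_mul_inv, div_le_iff₀ hk,
    lt_div_iff₀ hk]
  norm_num [add_assoc]

theorem measurableSet_cube {d : ℕ} (r : ℝ) (k : ℤ) (m : Fin d → ℤ) :
    MeasurableSet (cube r k m) := by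
  have : cube r k m = ⋂ i, (fun x : Rd d => x i) ⁻¹'
      Set.Ico (((m i : ℝ) + 1 / 2 - r / 2) * (2 : ℝ) ^ (-k))
        (((m i : ℝ) + 1 / 2 + r / 2) * (2 : ℝ) ^ (-k)) := by
    ext x
    simp [cube]
  rw [this]
  exact MeasurableSet.iInter fun i => (by fun_prop : Measurable fun x : Rd d => x i) measurableSet_Ico

theorem measurable_cubeIdx {d : ℕ} (k : ℤ) : Measurable (cubeIdx (d := d) k) :=
  measurable_pi_lambda _ fun i => Int.measurable_floor.comp (by fun_prop)

theorem volume_cube_one {d : ℕ} (k : ℤ) (m : Fin d → ℤ) :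
    volume (cube 1 k m) = ENNReal.ofReal ((2 : ℝ) ^ (-k)) ^ d := by
  have : cube 1 k m = (MeasurableEquiv.toLp 2 (Fin d → ℝ)).symm ⁻¹' (Set.univ.pi fun i =>
      Set.Ico (((m i : ℝ) + 1 / 2 - 1 / 2) * (2 : ℝ) ^ (-k))
        (((m i : ℝ) + 1 / 2 + 1 / 2) * (2 : ℝ) ^ (-k))) := by
    ext x
    simp [cube]
  rw [this, (EuclideanSpace.volume_preserving_symm_measurableEquiv_toLp
    (Fin d)).measure_preimage_equiv, volume_pi_pi]
  simp only [Real.volume_Ico]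
  rw [Finset.prod_congr rfl (g := fun _ => ENNReal.ofReal ((2 : ℝ) ^ (-k)))
    (fun i _ => by congr 1; ring)]
  simp

/-! ## `L₂(N)` for `N = L_∞(ℝᵈ) ⊗ M`, ball averages and dyadic conditional expectations -/

/-- `L₂(N) = L₂(ℝᵈ; L₂(M))`, in the sense of Bochner. -/
abbrev L2N (d : ℕ) (τ : NSFTrace M) : Type u := Lp (L2 τ) 2 (volume : Measure (Rd d))

section Averages

variable {d : ℕ} {τ : NSFTrace M}

theorem memLp_ballAvg (k : ℤ) (h : L2N d τ) :
    MemLp (fun x => ⨍ y in Metric.ball x ((2 : ℝ) ^ (-k)), h y) 2 volume := by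
  refine memLp_average (v := volume (Metric.ball (0 : Rd d) ((2 : ℝ) ^ (-k)))) ?_ ?_ ?_ ?_
    (Lp.memLp h)
  · exact measurableSet_lt (f := fun p : Rd d × Rd d => dist p.2 p.1) (by fun_prop) (by fun_prop)
  · intro x y
    exact Metric.mem_ball_comm
  · intro x
    exact Measure.addHaar_ball_center _ _ _
  · exact measure_ball_lt_top.ne

/-- `M_k h (x)` is the average of `h` over the ball of center `x` and radius `2⁻ᵏ`. -/
def ballAvg (k : ℤ) (h : L2N d τ) : L2N d τ := (memLp_ballAvg k h).toLp

theorem memLp_condExp (k : ℤ) (h : L2N d τ) :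
    MemLp (fun x => ⨍ y in cube 1 k (cubeIdx k x), h y) 2 volume := by
  refine memLp_average (v := ENNReal.ofReal ((2 : ℝ) ^ (-k)) ^ d) ?_ ?_ ?_ ?_ (Lp.memLp h)
  · simp only [mem_cube_one]
    exact measurableSet_eq_fun ((measurable_cubeIdx k).comp measurable_snd)
      ((measurable_cubeIdx k).comp measurable_fst)
  · intro x y
    rw [mem_cube_one, mem_cube_one, eq_comm]
  · intro x
    exact volume_cube_one _ _
  · simp

/-- `E_k h (x)` is the average of `h` over the dyadic cube of side length `2⁻ᵏ` containing `x`. -/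
def condExp (k : ℤ) (h : L2N d τ) : L2N d τ := (memLp_condExp k h).toLp

/-- The martingale difference `dh_k = E_k h - E_{k-1} h`. -/
def mdiff (k : ℤ) (h : L2N d τ) : L2N d τ := condExp k h - condExp (k - 1) h

/-- `T h = ∑_{k ∈ F} ε_k (M_k - E_k) h`, as a function on `Ω` with values in `L₂(N)`. -/
def radT {Ω : Type*} (ε : ℤ → Ω → ℝ) (F : Finset ℤ) (h : L2N d τ) (ω : Ω) : L2N d τ :=
  ∑ k ∈ F, (ε k ω : ℂ) • (ballAvg k h - condExp k h)

end Averages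

/-- `(ε_k)` is a sequence of independent random variables taking the values `1` and `-1`
with probability `1/2` each. -/
structure IsRademacher {Ω : Type*} [MeasurableSpace Ω] (ε : ℤ → Ω → ℝ) (P : Measure Ω) : Prop where
  measurable : ∀ k, Measurable (ε k)
  prob_one : ∀ k, P {ω | ε k ω = 1} = 1 / 2
  prob_neg_one : ∀ k, P {ω | ε k ω = -1} = 1 / 2
  indep : iIndepFun ε P

/-! ## The von Neumann algebras `N` and `N_k`, in their left action on `L₂(N)` -/

section Algebra

variable {H : Type u} [NormedAddCommGroup H] [InnerProductSpace ℂ H] [CompleteSpace H]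

/-- The von Neumann algebra on `H` generated by a set of operators (the double commutant of its
star-closure). -/
def generatedVN (s : Set (H →L[ℂ] H)) : VonNeumannAlgebra H where
  toStarSubalgebra := StarSubalgebra.centralizer ℂ (StarSubalgebra.centralizer ℂ s : Set (H →L[ℂ] H))
  centralizer_centralizer' := by
    change Set.centralizer (Set.centralizer (Set.centralizer _)) = _
    rw [Set.centralizer_centralizer_centralizer]
    rfl

/-- The supremum `⋁ᵢ pᵢ` of a family of projections: the orthogonal projection onto the closed
linear span of their ranges. It lies in every von Neumann algebra that contains all the `pᵢ`, and
is their supremum in its lattice of projections. -/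
def projSup {ι : Sort*} (p : ι → H →L[ℂ] H) : H →L[ℂ] H :=
  haveI : CompleteSpace (⨆ i, (p i).range).topologicalClosure :=
    (Submodule.isClosed_topologicalClosure _).completeSpace_coe
  (⨆ i, (p i).range).topologicalClosure.starProjection

end Algebra

section Indicator

variable {α E : Type*} [MeasurableSpace α] {μ : Measure α} [NormedAddCommGroup E]
  {S : Set α}

/-- Multiplication by the indicator function `1_S` on a Bochner space `L₂(α; E)`. -/
def indicatorFun (hS : MeasurableSet S) (h : Lp E 2 μ) : Lp E 2 μ :=
  ((Lp.memLp h).indicator hS).toLp (S.indicator h)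

theorem indicatorFun_ae (hS : MeasurableSet S) (h : Lp E 2 μ) :
    indicatorFun hS h =ᵐ[μ] S.indicator h :=
  MemLp.coeFn_toLp _

variable [NormedSpace ℂ E]

/-- `indicatorFun` as a bounded operator. -/
def indicatorL (hS : MeasurableSet S) : Lp E 2 μ →L[ℂ] Lp E 2 μ :=
  LinearMap.mkContinuous
    { toFun := indicatorFun hS
      map_add' := fun g h => by
        refine Lp.ext ?_
        filter_upwards [Lp.coeFn_add g h, indicatorFun_ae hS (g + h), indicatorFun_ae hS g,
          indicatorFun_ae hS h, Lp.coeFn_add (indicatorFun hS g) (indicatorFun hS h)]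
          with x h1 h2 h3 h4 h5
        rw [h2, h5, Pi.add_apply, h3, h4]
        simp only [Set.indicator, h1, Pi.add_apply]
        split_ifs <;> simp
      map_smul' := fun c h => by
        rw [RingHom.id_apply]
        refine Lp.ext ?_
        filter_upwards [Lp.coeFn_smul c h, indicatorFun_ae hS (c • h), indicatorFun_ae hS h,
          Lp.coeFn_smul c (indicatorFun hS h)] with x h1 h2 h3 h4
        rw [h2, h4, Pi.smul_apply, h3]
        simp only [Set.indicator, h1, Pi.smul_apply]
        split_ifs <;> simp }
    1 (fun h => by
      refine Lp.norm_le_mul_norm_of_ae_le_mul ?_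
      filter_upwards [indicatorFun_ae hS h] with x hx
      change ‖indicatorFun hS h x‖ ≤ _
      rw [one_mul, hx]
      exact norm_indicator_le_norm_self _ _)

theorem indicatorL_ae (hS : MeasurableSet S) (h : Lp E 2 μ) :
    indicatorL hS h =ᵐ[μ] S.indicator h :=
  indicatorFun_ae hS h

end Indicator

section Tensor

variable {d : ℕ} (τ : NSFTrace M)

/-- The elementary tensor `1_S ⊗ a`, acting on `L₂(N)` by `h ↦ (x ↦ 1_S(x) a h(x))`. -/
def indTensor {S : Set (Rd d)} (hS : MeasurableSet S) (a : M) : L2N d τ →L[ℂ] L2N d τ :=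
  (indicatorL hS).comp ((lmul τ a).compLpL 2 volume)

theorem indTensor_ae {S : Set (Rd d)} (hS : MeasurableSet S) (a : M) (h : L2N d τ) :
    indTensor τ hS a h =ᵐ[volume] S.indicator fun x => lmul τ a (h x) := by
  refine (indicatorL_ae hS ((lmul τ a).compLpL 2 volume h)).trans ?_
  filter_upwards [(lmul τ a).coeFn_compLpL (p := 2) (μ := volume) h] with x hx
  simp only [Set.indicator, hx]

/-- The von Neumann algebra tensor product `N = L_∞(ℝᵈ) ⊗ M`, acting on `L₂(N)` from the left:
it is generated by the elementary tensors `1_S ⊗ a`. -/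
def algN (d : ℕ) (τ : NSFTrace M) : VonNeumannAlgebra (L2N d τ) :=
  generatedVN {x | ∃ (S : Set (Rd d)) (hS : MeasurableSet S) (a : M), x = indTensor τ hS a}

/-- The von Neumann subalgebra `N_k = E_k(N)` of the elements that are constant on each dyadic cube
of side length `2⁻ᵏ`: it is generated by the `1_Q ⊗ a` for these cubes `Q`. -/
def algNk (d : ℕ) (τ : NSFTrace M) (k : ℤ) : VonNeumannAlgebra (L2N d τ) :=
  generatedVN {x | ∃ (m : Fin d → ℤ) (a : M), x = indTensor τ (measurableSet_cube 1 k m) a}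

/-- For projections `a_Q` of `M`, one for each dyadic cube `Q` of side length `2⁻ᵏ`, the projection
`⋁_Q a_Q 1_{rQ}` of `N`. -/
def cubeSup (r : ℝ) (k : ℤ) (a : (Fin d → ℤ) → M) : L2N d τ →L[ℂ] L2N d τ :=
  projSup fun m => indTensor τ (measurableSet_cube r k m) (a m)

/-- The involution `h ↦ h^*` of `L₂(N)`, that is `h^*(x) = h(x)^*`. -/
def starN : L2N d τ →L⋆[ℂ] L2N d τ := (starL2 τ).compLpL 2 volume

/-- The right multiplication `h ↦ h b` of `L₂(N)` by `b ∈ N`, that is `h b = (b^* h^*)^*`. -/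
def rightMul (b : L2N d τ →L[ℂ] L2N d τ) (h : L2N d τ) : L2N d τ := starN τ (star b (starN τ h))

end Tensor

end PseudoLoc

end

/-!
The generation-`(k + n)` martingale difference `dh_{k+n}` contributes `ε_k (M_k - E_k) dh_{k+n}` to
`T h`, and these contributions fall into two groups.

If `n ≤ s`, then `dh_{k+n}` is supported by `A_{k+n-s}`, hence is a limit of sums of functions with
values in `a_Q L₂(M)` on cubes `Q` of side length `2^{-(k+n-s)} ≥ 2⁻ᵏ`. Averaging over balls of
radius `2⁻ᵏ` or over cubes of side length `2⁻ᵏ` keeps such a function in the range of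
`1_{5Q} ⊗ a_Q`, so that the projection onto the complement of `⋁ₖ 5A_k` annihilates
`(M_k - E_k) dh_{k+n}` (`compl_projSup_ballAvg_eq_zero`, `compl_projSup_condExp_eq_zero`). As
`E_j h → 0` for `j → -∞` in positive dimension (`tendsto_condExp_neg`), only
`(M_k - E_k)(h - E_{k+s} h) = M_k (h - E_{k+s} h)` is left (`compl_projSup_sub_eq`).

If `n > s`, then `dh_{k+n}` has mean zero on the cubes of side length `2^{-(k+n-1)}`, so that only
the cubes that meet the boundary of a ball of radius `2⁻ᵏ` contribute to the average over this
ball. These cubes lie in a shell that makes up at most a fraction of order `2⁻ⁿ` of the ball, and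
Schur's test gives `‖M_k dh_{k+n}‖ ≤ C 2⁻ⁿ ‖dh_{k+n}‖` (`norm_ballAvg_le_of_condExp_eq_zero`).
Together with the orthogonality of martingale differences (`sum_norm_sq_mdiff_le`), summation over
`n > s` and `k` yields `∑ₖ ‖M_k (h - E_{k+s} h)‖² ≤ (C 2⁻ˢ ‖h‖)²` (`sum_norm_sq_ballAvg_le`), and
the left-hand side is the mean square of the random sum (`IsRademacher.eLpNorm_sum_smul`). The
decay obtained is `2⁻ˢ`, which is more than what is needed.

The estimate for the multiplication from the right is the one from the left for `h^*`, since the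
involution is isometric and commutes with `M_k` and `E_k`.
-/

noncomputable section

namespace PseudoLoc

/-! ### Averaging operators -/

section Schur

variable {α E G : Type*} [MeasurableSpace α] [NormedAddCommGroup E] [NormedAddCommGroup G]
  {μ : Measure α} [SFinite μ]

/-- Schur's test for the kernel `c 1_{y ∈ S x}` of a symmetric relation all of whose sections have
measure at most `v`. -/
theorem eLpNorm_le_of_enorm_le_setLIntegral {S : α → Set α}
    (hS : MeasurableSet {p : α × α | p.2 ∈ S p.1}) (hsymm : ∀ x y, y ∈ S x ↔ x ∈ S y)
    {c v : ℝ≥0∞} (hc : c ≠ ∞) (hv : ∀ x, μ (S x) ≤ v) (hv_top : v ≠ ∞) {f : α → E}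
    (hf : AEStronglyMeasurable f μ) {F : α → G}
    (hF : ∀ᵐ x ∂μ, ‖F x‖ₑ ≤ c * ∫⁻ y in S x, ‖f y‖ₑ ∂μ) :
    eLpNorm F 2 μ ≤ c * v * eLpNorm f 2 μ := by
  have hSx : ∀ x, MeasurableSet (S x) := fun x => measurable_prodMk_left hS
  have hfe : AEMeasurable (fun y => ‖f y‖ₑ) μ := hf.enorm
  have key : ∀ᵐ x ∂μ, ‖F x‖ₑ ^ (2 : ℝ) ≤
      c ^ (2 : ℝ) * v * ∫⁻ y, (S x).indicator (fun y => ‖f y‖ₑ ^ (2 : ℝ)) y ∂μ := by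
    filter_upwards [hF] with x hx
    have h2 := ENNReal.lintegral_mul_le_Lp_mul_Lq (μ.restrict (S x))
      (Real.HolderConjugate.two_two) hfe.restrict (aemeasurable_const (b := (1 : ℝ≥0∞)))
    simp only [Pi.mul_apply, mul_one, ENNReal.one_rpow, lintegral_const, one_mul,
      Measure.restrict_apply_univ] at h2
    have h3 : μ (S x) ^ (1 / 2 : ℝ) ≤ v ^ (1 / 2 : ℝ) :=
      ENNReal.rpow_le_rpow (hv x) (by norm_num)
    calc ‖F x‖ₑ ^ (2 : ℝ)
        ≤ (c * ((∫⁻ y in S x, ‖f y‖ₑ ^ (2 : ℝ) ∂μ) ^ (1 / 2 : ℝ) * v ^ (1 / 2 : ℝ))) ^ (2 : ℝ) := by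
          refine ENNReal.rpow_le_rpow (hx.trans ?_) (by norm_num)
          gcongr
          exact h2.trans (by gcongr)
      _ = c ^ (2 : ℝ) * v * ∫⁻ y, (S x).indicator (fun y => ‖f y‖ₑ ^ (2 : ℝ)) y ∂μ := by
          rw [lintegral_indicator (hSx x), ENNReal.mul_rpow_of_nonneg _ _ (by norm_num),
            ENNReal.mul_rpow_of_nonneg _ _ (by norm_num), ← ENNReal.rpow_mul, ← ENNReal.rpow_mul]
          norm_num
          ring
  have hm2 : AEMeasurable (Function.uncurry fun x y =>
      (S x).indicator (fun y => ‖f y‖ₑ ^ (2 : ℝ)) y) (μ.prod μ) :=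
    ((hf.comp_snd (μ := μ)).enorm.pow_const (2 : ℝ)).indicator hS
  have total : ∫⁻ x, ‖F x‖ₑ ^ (2 : ℝ) ∂μ ≤ (c * v) ^ (2 : ℝ) * ∫⁻ y, ‖f y‖ₑ ^ (2 : ℝ) ∂μ :=
    calc ∫⁻ x, ‖F x‖ₑ ^ (2 : ℝ) ∂μ
        ≤ ∫⁻ x, c ^ (2 : ℝ) * v *
            ∫⁻ y, (S x).indicator (fun y => ‖f y‖ₑ ^ (2 : ℝ)) y ∂μ ∂μ := lintegral_mono_ae key
      _ = c ^ (2 : ℝ) * v * ∫⁻ x, ∫⁻ y, (S x).indicator (fun y => ‖f y‖ₑ ^ (2 : ℝ)) y ∂μ ∂μ :=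
          lintegral_const_mul' _ _ (by finiteness)
      _ = c ^ (2 : ℝ) * v * ∫⁻ y, ∫⁻ x, (S x).indicator (fun y => ‖f y‖ₑ ^ (2 : ℝ)) y ∂μ ∂μ := by
          rw [lintegral_lintegral_swap hm2]
      _ ≤ c ^ (2 : ℝ) * v * ∫⁻ y, v * ‖f y‖ₑ ^ (2 : ℝ) ∂μ := by
          refine mul_le_mul_right (lintegral_mono fun y => ?_) _
          have : (fun x => (S x).indicator (fun y => ‖f y‖ₑ ^ (2 : ℝ)) y) =
              (S y).indicator (fun _ => ‖f y‖ₑ ^ (2 : ℝ)) := by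
            funext x
            by_cases h : y ∈ S x
            · rw [Set.indicator_of_mem h, Set.indicator_of_mem ((hsymm x y).1 h)]
            · rw [Set.indicator_of_notMem h, Set.indicator_of_notMem (mt (hsymm x y).2 h)]
          rw [this, lintegral_indicator (hSx y), lintegral_const, Measure.restrict_apply_univ,
            mul_comm]
          exact mul_le_mul_left (hv y) _
      _ = (c * v) ^ (2 : ℝ) * ∫⁻ y, ‖f y‖ₑ ^ (2 : ℝ) ∂μ := by
          rw [lintegral_const_mul' _ _ hv_top, ENNReal.mul_rpow_of_nonneg _ _ (by norm_num)]
          simp only [ENNReal.rpow_two]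
          ring
  rw [eLpNorm_eq_lintegral_rpow_enorm_toReal (by norm_num) (by norm_num),
    eLpNorm_eq_lintegral_rpow_enorm_toReal (by norm_num) (by norm_num), ENNReal.toReal_ofNat]
  refine (ENNReal.rpow_le_rpow total (by norm_num)).trans_eq ?_
  rw [ENNReal.mul_rpow_of_nonneg _ _ (by norm_num), ← ENNReal.rpow_mul]
  norm_num

end Schur

section SetAverage

variable {α E : Type*} [MeasurableSpace α] [NormedAddCommGroup E] {μ : Measure α} {T : Set α}

theorem integrableOn_of_memLp_two {f : α → E} (hf : MemLp f 2 μ) (hT : μ T ≠ ∞) :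
    IntegrableOn f T μ :=
  haveI : IsFiniteMeasure (μ.restrict T) := ⟨by simpa using hT.lt_top⟩
  (hf.restrict T).integrable (by norm_num)

variable [NormedSpace ℂ E]

theorem setAverage_Lp_add (f g : Lp E 2 μ) (hT : μ T ≠ ∞) :
    ⨍ y in T, (f + g : Lp E 2 μ) y ∂μ = ⨍ y in T, f y ∂μ + ⨍ y in T, g y ∂μ := by
  rw [setAverage_eq, setAverage_eq, setAverage_eq, ← smul_add,
    ← integral_add (integrableOn_of_memLp_two (Lp.memLp f) hT)
      (integrableOn_of_memLp_two (Lp.memLp g) hT)]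
  congr 1
  exact integral_congr_ae (ae_restrict_of_ae (Lp.coeFn_add f g))

theorem setAverage_Lp_smul (c : ℂ) (f : Lp E 2 μ) :
    ⨍ y in T, (c • f : Lp E 2 μ) y ∂μ = c • ⨍ y in T, f y ∂μ := by
  rw [setAverage_eq, setAverage_eq, integral_congr_ae (ae_restrict_of_ae (Lp.coeFn_smul c f))]
  simp only [Pi.smul_apply]
  rw [integral_smul, smul_comm]

theorem enorm_setAverage_le (f : α → E) :
    ‖⨍ y in T, f y ∂μ‖ₑ ≤ (μ T)⁻¹ * ∫⁻ y in T, ‖f y‖ₑ ∂μ := by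
  rw [setAverage_eq, enorm_smul]
  rcases eq_or_ne (μ T) 0 with h0 | h0
  · simp [measureReal_def, h0]
  gcongr
  · rw [measureReal_def, ← ENNReal.toReal_inv, Real.enorm_of_nonneg ENNReal.toReal_nonneg]
    exact ENNReal.ofReal_toReal_le
  · exact enorm_integral_le_lintegral_enorm _

end SetAverage

section Operators

variable {M : Type u} [CStarAlgebra M] [PartialOrder M] [StarOrderedRing M]
  {d : ℕ} {τ : NSFTrace M}

theorem ballAvg_ae (k : ℤ) (h : L2N d τ) :
    ballAvg k h =ᵐ[volume] fun x => ⨍ y in Metric.ball x ((2 : ℝ) ^ (-k)), h y :=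
  MemLp.coeFn_toLp _

theorem condExp_ae (k : ℤ) (h : L2N d τ) :
    condExp k h =ᵐ[volume] fun x => ⨍ y in cube 1 k (cubeIdx k x), h y :=
  MemLp.coeFn_toLp _

theorem volume_cube_ne_top (k : ℤ) (m : Fin d → ℤ) : volume (cube 1 k m) ≠ ∞ := by
  rw [volume_cube_one]
  finiteness

theorem volume_cube_ne_zero (k : ℤ) (m : Fin d → ℤ) : volume (cube 1 k m) ≠ 0 := by
  rw [volume_cube_one]
  have : (0 : ℝ) < 2 ^ (-k) := by positivity
  positivity

/-- Schur's test as a norm bound in `L₂(N)`. -/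
theorem norm_le_of_enorm_le {S : Rd d → Set (Rd d)}
    (hS : MeasurableSet {p : Rd d × Rd d | p.2 ∈ S p.1}) (hsymm : ∀ x y, y ∈ S x ↔ x ∈ S y)
    {c v : ℝ≥0∞} (hc : c ≠ ∞) (hv : ∀ x, volume (S x) ≤ v) (hv_top : v ≠ ∞) (f g : L2N d τ)
    (hg : ∀ᵐ x, ‖g x‖ₑ ≤ c * ∫⁻ y in S x, ‖f y‖ₑ) : ‖g‖ ≤ (c * v).toReal * ‖f‖ := by
  have h := eLpNorm_le_of_enorm_le_setLIntegral hS hsymm hc hv hv_top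
    (Lp.aestronglyMeasurable f) hg
  rw [Lp.norm_def, Lp.norm_def, ← ENNReal.toReal_mul]
  exact ENNReal.toReal_mono (ENNReal.mul_ne_top (by finiteness) (Lp.eLpNorm_ne_top f)) h

theorem measurableSet_ballRel (r : ℝ) :
    MeasurableSet {p : Rd d × Rd d | p.2 ∈ Metric.ball p.1 r} :=
  measurableSet_lt (f := fun p : Rd d × Rd d => dist p.2 p.1) (by fun_prop) (by fun_prop)

theorem norm_ballAvg_le (k : ℤ) (h : L2N d τ) : ‖ballAvg k h‖ ≤ ‖h‖ := by
  have hr : (0 : ℝ) < 2 ^ (-k) := by positivity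
  have hV0 := (Metric.measure_ball_pos (volume : Measure (Rd d)) 0 hr).ne'
  have hV : volume (Metric.ball (0 : Rd d) ((2 : ℝ) ^ (-k))) ≠ ∞ := measure_ball_lt_top.ne
  have := norm_le_of_enorm_le (S := fun x => Metric.ball x ((2 : ℝ) ^ (-k)))
    (measurableSet_ballRel _) (fun x y => Metric.mem_ball_comm) (ENNReal.inv_ne_top.2 hV0)
    (fun x => (Measure.addHaar_ball_center _ x _).le) hV h (ballAvg k h) (by
      filter_upwards [ballAvg_ae k h] with x hx
      rw [hx, ← Measure.addHaar_ball_center volume x]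
      exact enorm_setAverage_le _)
  rwa [ENNReal.inv_mul_cancel hV0 hV, ENNReal.toReal_one, one_mul] at this

theorem norm_condExp_le (k : ℤ) (h : L2N d τ) : ‖condExp k h‖ ≤ ‖h‖ := by
  have hV0 := volume_cube_ne_zero (d := d) k 0
  have hV := volume_cube_ne_top (d := d) k 0
  have := norm_le_of_enorm_le (S := fun x => cube 1 k (cubeIdx k x)) (by
      simp only [mem_cube_one]
      exact measurableSet_eq_fun ((measurable_cubeIdx k).comp measurable_snd)
        ((measurable_cubeIdx k).comp measurable_fst))
    (fun x y => by rw [mem_cube_one, mem_cube_one, eq_comm]) (ENNReal.inv_ne_top.2 hV0)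
    (v := volume (cube (d := d) 1 k 0))
    (fun x => by rw [volume_cube_one, volume_cube_one]) hV h (condExp k h) (by
      filter_upwards [condExp_ae k h] with x hx
      rw [hx, volume_cube_one k 0, ← volume_cube_one k (cubeIdx k x)]
      exact enorm_setAverage_le _)
  rwa [ENNReal.inv_mul_cancel hV0 hV, ENNReal.toReal_one, one_mul] at this

/-- The ball average `M_k` as a bounded operator. -/
def ballAvgL (k : ℤ) : L2N d τ →L[ℂ] L2N d τ :=
  LinearMap.mkContinuous
    { toFun := ballAvg k
      map_add' := fun f g => by
        refine Lp.ext ?_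
        filter_upwards [ballAvg_ae k (f + g), ballAvg_ae k f, ballAvg_ae k g,
          Lp.coeFn_add (ballAvg k f) (ballAvg k g)] with x h1 h2 h3 h4
        rw [h1, h4, Pi.add_apply, h2, h3, setAverage_Lp_add f g measure_ball_lt_top.ne]
      map_smul' := fun c f => by
        refine Lp.ext ?_
        filter_upwards [ballAvg_ae k (c • f), ballAvg_ae k f, Lp.coeFn_smul c (ballAvg k f)]
          with x h1 h2 h3
        rw [h1, RingHom.id_apply, h3, Pi.smul_apply, h2, setAverage_Lp_smul c f] }
    1 (fun h => by rw [one_mul]; exact norm_ballAvg_le k h)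

theorem ballAvgL_apply (k : ℤ) (h : L2N d τ) : ballAvgL k h = ballAvg k h := rfl

/-- The dyadic conditional expectation `E_k` as a bounded operator. -/
def condExpL (k : ℤ) : L2N d τ →L[ℂ] L2N d τ :=
  LinearMap.mkContinuous
    { toFun := condExp k
      map_add' := fun f g => by
        refine Lp.ext ?_
        filter_upwards [condExp_ae k (f + g), condExp_ae k f, condExp_ae k g,
          Lp.coeFn_add (condExp k f) (condExp k g)] with x h1 h2 h3 h4
        rw [h1, h4, Pi.add_apply, h2, h3, setAverage_Lp_add f g (volume_cube_ne_top _ _)]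
      map_smul' := fun c f => by
        refine Lp.ext ?_
        filter_upwards [condExp_ae k (c • f), condExp_ae k f, Lp.coeFn_smul c (condExp k f)]
          with x h1 h2 h3
        rw [h1, RingHom.id_apply, h3, Pi.smul_apply, h2, setAverage_Lp_smul c f] }
    1 (fun h => by rw [one_mul]; exact norm_condExp_le k h)

theorem condExpL_apply (k : ℤ) (h : L2N d τ) : condExpL k h = condExp k h := rfl

end Operators

/-! ### The dyadic filtration -/

section Cubes

variable {d : ℕ}

/-- Dyadic cubes are nested. -/
theorem cubeIdx_eq_of_le {k l : ℤ} (hkl : k ≤ l) {x y : Rd d} (h : cubeIdx l x = cubeIdx l y) :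
    cubeIdx k x = cubeIdx k y := by
  obtain ⟨n, rfl⟩ := Int.le.dest hkl
  have e : ∀ z : Rd d, ∀ i, cubeIdx k z i = cubeIdx (k + n) z i / ((2 ^ n : ℕ) : ℤ) := by
    intro z i
    rw [cubeIdx, cubeIdx, ← Int.floor_div_natCast, zpow_add₀ (by norm_num)]
    congr 1
    push_cast
    rw [zpow_natCast]
    field_simp
  funext i
  rw [e, e, h]

variable {E : Type*} [NormedAddCommGroup E] [NormedSpace ℝ E]

/-- Two functions with the same integrals over the dyadic cubes of a generation have the same
integral over every union `U` of such cubes. -/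
theorem setIntegral_eq_of_cubes (l : ℤ) {U : Set (Rd d)}
    (hU : ∀ x y, cubeIdx l x = cubeIdx l y → x ∈ U → y ∈ U) {f g : Rd d → E}
    (hf : IntegrableOn f U) (hg : IntegrableOn g U)
    (hfg : ∀ m, ∫ x in cube 1 l m, f x = ∫ x in cube 1 l m, g x) :
    ∫ x in U, f x = ∫ x in U, g x := by
  have e : U = ⋃ m : cubeIdx l '' U, cube 1 l (m : Fin d → ℤ) := by
    ext y
    simp only [Set.mem_iUnion, mem_cube_one, Subtype.exists, Set.mem_image, exists_prop]
    constructor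
    · exact fun hy => ⟨_, ⟨y, hy, rfl⟩, rfl⟩
    · rintro ⟨_, ⟨x, hx, rfl⟩, h⟩
      exact hU x y h.symm hx
  have hd : Pairwise (Function.onFun Disjoint
      fun m : cubeIdx l '' U => cube (d := d) 1 l (m : Fin d → ℤ)) := by
    intro m n hmn
    refine Set.disjoint_left.2 fun x hx hx' => hmn (Subtype.ext ?_)
    rw [mem_cube_one] at hx hx'
    rw [← hx, ← hx']
  rw [e] at hf hg ⊢
  rw [integral_iUnion (fun m => measurableSet_cube 1 l _) hd hf,
    integral_iUnion (fun m => measurableSet_cube 1 l _) hd hg]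
  exact tsum_congr fun m => hfg _

end Cubes

section Tower

variable {M : Type u} [CStarAlgebra M] [PartialOrder M] [StarOrderedRing M]
  {d : ℕ} {τ : NSFTrace M}

theorem setIntegral_condExp_self (k : ℤ) (m : Fin d → ℤ) (h : L2N d τ) :
    ∫ x in cube 1 k m, condExp k h x = ∫ x in cube 1 k m, h x := by
  have : ∫ x in cube 1 k m, condExp k h x = ∫ _ in cube 1 k m, ⨍ y in cube 1 k m, h y := by
    refine setIntegral_congr_ae (measurableSet_cube 1 k m) ?_
    filter_upwards [condExp_ae k h] with x hx hxm
    rw [hx, (mem_cube_one k m x).1 hxm]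
  rw [this, setIntegral_const, measure_smul_setAverage _ (volume_cube_ne_top k m)]

theorem setIntegral_condExp {k l : ℤ} (hkl : k ≤ l) (m : Fin d → ℤ) (h : L2N d τ) :
    ∫ x in cube 1 k m, condExp l h x = ∫ x in cube 1 k m, h x := by
  refine setIntegral_eq_of_cubes l (fun x y hxy hx => ?_)
    (integrableOn_of_memLp_two (Lp.memLp _) (volume_cube_ne_top k m))
    (integrableOn_of_memLp_two (Lp.memLp _) (volume_cube_ne_top k m))
    (fun m => setIntegral_condExp_self l m h)
  rw [mem_cube_one] at hx ⊢
  rw [← cubeIdx_eq_of_le hkl hxy, hx]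

theorem condExp_condExp_of_le {k l : ℤ} (hkl : k ≤ l) (h : L2N d τ) :
    condExp k (condExp l h) = condExp k h := by
  refine Lp.ext ?_
  filter_upwards [condExp_ae k (condExp l h), condExp_ae k h] with x h1 h2
  rw [h1, h2, setAverage_eq, setAverage_eq, setIntegral_condExp hkl]

theorem condExp_mdiff (k : ℤ) (h : L2N d τ) : condExp (k - 1) (mdiff k h) = 0 := by
  rw [mdiff, ← condExpL_apply, map_sub, condExpL_apply, condExpL_apply,
    condExp_condExp_of_le (by lia), condExp_condExp_of_le le_rfl, sub_self]

theorem setIntegral_eq_zero_of_condExp_eq_zero {k : ℤ} {h : L2N d τ} (hh : condExp k h = 0)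
    (m : Fin d → ℤ) : ∫ x in cube 1 k m, h x = 0 := by
  rw [← setIntegral_condExp_self k m h, hh]
  exact integral_eq_zero_of_ae (ae_restrict_of_ae (Lp.coeFn_zero _ _ _))

end Tower

/-! ### Ball averages of functions with mean zero on small cubes -/

section Shell

variable {d : ℕ}

/-- The diameter of a dyadic cube of side length `2⁻ᵏ` is at most `d 2⁻ᵏ`. -/
theorem dist_le_of_cubeIdx_eq {k : ℤ} {x y : Rd d} (h : cubeIdx k x = cubeIdx k y) :
    dist x y ≤ d * (2 : ℝ) ^ (-k) := by
  have hk : (0 : ℝ) < 2 ^ (-k) := by positivity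
  have hc : ∀ i, dist (x i) (y i) ≤ (2 : ℝ) ^ (-k) := by
    intro i
    have hx := (mem_cube_one k _ x).2 rfl i
    have hy := (mem_cube_one k _ y).2 h.symm i
    rw [Real.dist_eq, abs_le]
    constructor <;> linarith
  rw [EuclideanSpace.dist_eq, Real.sqrt_le_iff]
  refine ⟨by positivity, ?_⟩
  calc ∑ i, dist (x i) (y i) ^ 2 ≤ ∑ _i : Fin d, ((2 : ℝ) ^ (-k)) ^ 2 := by
        gcongr with i
        exact hc i
    _ = d * ((2 : ℝ) ^ (-k)) ^ 2 := by simp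
    _ ≤ d ^ 2 * ((2 : ℝ) ^ (-k)) ^ 2 := by
        gcongr
        rcases Nat.eq_zero_or_pos d with rfl | hd
        · simp
        · exact_mod_cast Nat.le_self_pow two_ne_zero d
    _ = (d * (2 : ℝ) ^ (-k)) ^ 2 := by ring

/-- The spherical shell of the points `y` with `r - δ ≤ |y - x| < r`. -/
def shell (r δ : ℝ) (x : Rd d) : Set (Rd d) := Metric.ball x r \ Metric.ball x (r - δ)

/-- A shell of width `δ` makes up at most the fraction `d δ / r` of its ball, by Bernoulli's
inequality. -/
theorem volume_shell_le (hd : d ≠ 0) {r δ : ℝ} (hr : 0 < r) (hδ : 0 ≤ δ) (x : Rd d) :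
    volume (shell r δ x) ≤
      ENNReal.ofReal (d * (δ / r)) * volume (Metric.ball (0 : Rd d) r) := by
  set V := volume (Metric.ball (0 : Rd d) r) with hV
  have hVx : volume (Metric.ball x r) = V := Measure.addHaar_ball_center _ _ _
  have hVt : V ≠ ∞ := measure_ball_lt_top.ne
  rcases le_total δ r with hδr | hδr
  · set t := δ / r with ht
    have ht0 : 0 ≤ t := by positivity
    have ht1 : t ≤ 1 := (div_le_one hr).2 hδr
    have hin : ENNReal.ofReal ((1 - t) ^ d) * V ≤ volume (Metric.ball x (r - δ)) := by
      rcases eq_or_lt_of_le ht1 with h1 | h1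
      · simp [h1, hd]
      · have e : r - δ = (1 - t) * r := by rw [ht]; field_simp
        rw [e, Measure.addHaar_ball_mul_of_pos _ _ (by linarith), finrank_euclideanSpace_fin]
    have hmeas : volume (shell r δ x) = V - volume (Metric.ball x (r - δ)) := by
      rw [shell, measure_sdiff (Metric.ball_subset_ball (by linarith))
        measurableSet_ball.nullMeasurableSet measure_ball_lt_top.ne, hVx]
    have hb : 1 + (d : ℝ) * (-t) ≤ (1 + -t) ^ d := one_add_mul_le_pow (by linarith) d
    rw [hmeas, tsub_le_iff_right]
    calc V = ENNReal.ofReal 1 * V := by simp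
      _ ≤ (ENNReal.ofReal (d * t) + ENNReal.ofReal ((1 - t) ^ d)) * V := by
          rw [← ENNReal.ofReal_add (by positivity) (pow_nonneg (by linarith) _)]
          gcongr
          rw [← sub_eq_add_neg] at hb
          linarith
      _ ≤ ENNReal.ofReal (d * t) * V + volume (Metric.ball x (r - δ)) := by
          rw [add_mul]
          gcongr
  · have h1 : (1 : ℝ) ≤ d * (δ / r) := by
      have : (1 : ℝ) ≤ d := by exact_mod_cast Nat.one_le_iff_ne_zero.2 hd
      nlinarith [(one_le_div hr).2 hδr]
    calc volume (shell r δ x) ≤ 1 * V := by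
          rw [one_mul, ← hVx]
          exact measure_mono Set.sdiff_subset
      _ ≤ ENNReal.ofReal (d * (δ / r)) * V := by
          gcongr
          exact ENNReal.one_le_ofReal.2 h1

variable {M : Type u} [CStarAlgebra M] [PartialOrder M] [StarOrderedRing M] {τ : NSFTrace M}

/-- Only the cubes that meet the boundary of a ball contribute to the average over this ball of a
function with mean zero on all cubes of side length `2⁻ᴺ`. -/
theorem enorm_ballAvg_le {N : ℤ} {g : L2N d τ} (hg : condExp N g = 0) {r : ℝ} (x : Rd d) :
    ‖⨍ y in Metric.ball x r, g y‖ₑ ≤ (volume (Metric.ball (0 : Rd d) r))⁻¹ *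
      ∫⁻ y in shell r (d * (2 : ℝ) ^ (-N)) x, ‖g y‖ₑ := by
  -- `U` is the union of the cubes contained in the ball.
  set U : Set (Rd d) := {y | ∀ z, cubeIdx N z = cubeIdx N y → z ∈ Metric.ball x r} with hU
  have hUcube : ∀ y z, cubeIdx N y = cubeIdx N z → y ∈ U → z ∈ U :=
    fun y z hyz hy w hw => hy w (hw.trans hyz.symm)
  have hUball : U ⊆ Metric.ball x r := fun y hy => hy y rfl
  have hUm : MeasurableSet U := by
    have : U = cubeIdx N ⁻¹' (cubeIdx N '' U) := by
      refine Set.Subset.antisymm (Set.subset_preimage_image _ _) ?_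
      rintro y ⟨z, hz, hzy⟩
      exact hUcube z y hzy hz
    rw [this]
    exact measurable_cubeIdx N (Set.to_countable _).measurableSet
  have hint : IntegrableOn g (Metric.ball x r) :=
    integrableOn_of_memLp_two (Lp.memLp g) measure_ball_lt_top.ne
  have hU0 : ∫ y in U, g y = 0 := by
    have := setIntegral_eq_of_cubes N hUcube (hint.mono_set hUball)
      (g := fun _ => (0 : L2 τ)) (integrableOn_zero) (fun m => by
        rw [setIntegral_eq_zero_of_condExp_eq_zero hg m, integral_zero])
    rw [this, integral_zero]
  have hsub : Metric.ball x r \ U ⊆ shell r (d * (2 : ℝ) ^ (-N)) x := by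
    rintro y ⟨hy, hyU⟩
    refine ⟨hy, fun hy' => hyU fun z hz => ?_⟩
    have h1 := dist_le_of_cubeIdx_eq hz
    have h2 := dist_triangle z y x
    rw [Metric.mem_ball] at hy' ⊢
    linarith
  have hsplit : ∫ y in Metric.ball x r, g y = ∫ y in Metric.ball x r \ U, g y := by
    rw [← integral_inter_add_sdiff hUm hint, Set.inter_eq_self_of_subset_right hUball, hU0,
      zero_add]
  rcases eq_or_ne (volume (Metric.ball x r)) 0 with h0 | h0
  · simp [setAverage_eq, measureReal_def, h0]
  rw [setAverage_eq, enorm_smul, hsplit, ← Measure.addHaar_ball_center volume x r]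
  gcongr
  · rw [measureReal_def, ← ENNReal.toReal_inv, Real.enorm_of_nonneg ENNReal.toReal_nonneg]
    exact ENNReal.ofReal_toReal_le
  · exact (enorm_integral_le_lintegral_enorm _).trans (lintegral_mono_set hsub)

/-- Ball averages of radius `2⁻ᵏ` are small on functions with mean zero on the cubes of side length
`2⁻ᴺ`: the shell of width `d 2⁻ᴺ` is a fraction `d² 2^{k-N}` of the ball. -/
theorem norm_ballAvg_le_of_condExp_eq_zero (hd : d ≠ 0) (k : ℤ) {N : ℤ} {g : L2N d τ}
    (hg : condExp N g = 0) : ‖ballAvg k g‖ ≤ d ^ 2 * (2 : ℝ) ^ (k - N) * ‖g‖ := by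
  have hr : (0 : ℝ) < 2 ^ (-k) := by positivity
  set V := volume (Metric.ball (0 : Rd d) ((2 : ℝ) ^ (-k))) with hV
  have hV0 : V ≠ 0 := (Metric.measure_ball_pos (volume : Measure (Rd d)) 0 hr).ne'
  have hVt : V ≠ ∞ := measure_ball_lt_top.ne
  have hδ : (0 : ℝ) ≤ d * (2 : ℝ) ^ (-N) := by positivity
  have := norm_le_of_enorm_le (S := shell ((2 : ℝ) ^ (-k)) (d * (2 : ℝ) ^ (-N)))
    ((measurableSet_ballRel _).diff (measurableSet_ballRel _))
    (fun x y => by simp only [shell, Set.mem_sdiff, Metric.mem_ball_comm])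
    (ENNReal.inv_ne_top.2 hV0) (fun x => volume_shell_le hd hr hδ x)
    (ENNReal.mul_ne_top ENNReal.ofReal_ne_top hVt) g (ballAvg k g) (by
      filter_upwards [ballAvg_ae k g] with x hx
      rw [hx]
      exact enorm_ballAvg_le hg x)
  refine this.trans_eq ?_
  rw [← hV, mul_left_comm, ENNReal.inv_mul_cancel hV0 hVt, mul_one,
    ENNReal.toReal_ofReal (by positivity)]
  congr 1
  rw [sub_eq_neg_add, zpow_add₀ (by norm_num), zpow_neg _ k]
  field_simp

end Shell

/-! ### Orthogonality of martingale differences -/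

section Orthogonality

variable {H : Type*} [NormedAddCommGroup H] [InnerProductSpace ℂ H]

/-- A contractive idempotent has orthogonal range and kernel. -/
theorem re_inner_sub_eq_zero_of_contraction {P : H →L[ℂ] H} (hP : ∀ x, ‖P x‖ ≤ ‖x‖)
    (hPP : ∀ x, P (P x) = P x) (x : H) : (inner ℂ (P x) (x - P x)).re = 0 := by
  set y := P x
  set z := x - P x
  -- `‖y‖ ≤ ‖y + t z‖` for all real `t`, so a quadratic in `t` without constant term is nonnegative.
  have key : ∀ t : ℝ, 0 ≤ ‖z‖ ^ 2 * (t * t) + 2 * (inner ℂ y z).re * t + 0 := by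
    intro t
    have h1 : P (y + (t : ℂ) • z) = y := by
      simp only [y, z, map_add, map_smul, map_sub, hPP, sub_self, smul_zero, add_zero]
    have h2 := hP (y + (t : ℂ) • z)
    rw [h1] at h2
    have h3 := pow_le_pow_left₀ (norm_nonneg _) h2 2
    rw [norm_add_sq (𝕜 := ℂ), inner_smul_right, norm_smul, mul_pow] at h3
    simp only [RCLike.re_to_complex, Complex.re_ofReal_mul, Complex.norm_real, Real.norm_eq_abs,
      sq_abs] at h3
    linarith
  have := discrim_le_zero key
  rw [discrim] at this
  nlinarith

theorem norm_sq_eq_add_of_contraction {P : H →L[ℂ] H} (hP : ∀ x, ‖P x‖ ≤ ‖x‖)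
    (hPP : ∀ x, P (P x) = P x) (x : H) : ‖x‖ ^ 2 = ‖P x‖ ^ 2 + ‖x - P x‖ ^ 2 := by
  have h := norm_add_sq (𝕜 := ℂ) (P x) (x - P x)
  rw [RCLike.re_to_complex, re_inner_sub_eq_zero_of_contraction hP hPP x,
    add_sub_cancel] at h
  linarith

variable {M : Type u} [CStarAlgebra M] [PartialOrder M] [StarOrderedRing M]
  {d : ℕ} {τ : NSFTrace M}

theorem norm_sq_mdiff (k : ℤ) (h : L2N d τ) :
    ‖mdiff k h‖ ^ 2 = ‖condExp k h‖ ^ 2 - ‖condExp (k - 1) h‖ ^ 2 := by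
  have := norm_sq_eq_add_of_contraction (P := condExpL (k - 1))
    (norm_condExp_le (τ := τ) (d := d) (k - 1)) (fun x => condExp_condExp_of_le le_rfl x) (condExp k h)
  rw [condExpL_apply, condExp_condExp_of_le (by lia)] at this
  rw [mdiff, this, add_sub_cancel_left]

theorem norm_sub_condExp_le (k : ℤ) (h : L2N d τ) : ‖h - condExp k h‖ ≤ ‖h‖ := by
  have := norm_sq_eq_add_of_contraction (P := condExpL k) (norm_condExp_le (τ := τ) (d := d) k)
    (fun x => condExp_condExp_of_le le_rfl x) h
  rw [condExpL_apply] at this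
  exact le_of_sq_le_sq (by nlinarith [sq_nonneg ‖condExp k h‖]) (norm_nonneg _)

/-- Bessel's inequality for the martingale differences. -/
theorem sum_norm_sq_mdiff_le (F : Finset ℤ) (h : L2N d τ) :
    ∑ k ∈ F, ‖mdiff k h‖ ^ 2 ≤ ‖h‖ ^ 2 := by
  have tel : ∀ (a : ℤ) (n : ℕ), ∑ i ∈ Finset.range n, ‖mdiff (a + i + 1) h‖ ^ 2 =
      ‖condExp (a + n) h‖ ^ 2 - ‖condExp a h‖ ^ 2 := by
    intro a n
    induction n with
    | zero => simp
    | succ n ih =>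
      rw [Finset.sum_range_succ, ih, norm_sq_mdiff, add_sub_cancel_right]
      push_cast
      rw [← add_assoc]
      ring
  obtain ⟨a, ha⟩ := F.bddBelow
  obtain ⟨b, hb⟩ := F.bddAbove
  calc ∑ k ∈ F, ‖mdiff k h‖ ^ 2
      ≤ ∑ k ∈ (Finset.range (b - a + 1).toNat).image (fun i : ℕ => a - 1 + i + 1),
          ‖mdiff k h‖ ^ 2 := by
        refine Finset.sum_le_sum_of_subset_of_nonneg (fun k hk => ?_) fun _ _ _ => by positivity
        have h1 := ha hk
        have h2 := hb hk
        simp only [Finset.mem_image, Finset.mem_range]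
        exact ⟨(k - a).toNat, by lia, by lia⟩
    _ = ∑ i ∈ Finset.range (b - a + 1).toNat, ‖mdiff (a - 1 + i + 1) h‖ ^ 2 :=
        Finset.sum_image fun i _ j _ hij => by simpa using hij
    _ ≤ ‖h‖ ^ 2 := by
        rw [tel]
        have := pow_le_pow_left₀ (norm_nonneg _)
          (norm_condExp_le (a - 1 + ((b - a + 1).toNat : ℤ)) h) 2
        nlinarith [sq_nonneg ‖condExp (a - 1) h‖]

end Orthogonality

section Vanishing

variable {M : Type u} [CStarAlgebra M] [PartialOrder M] [StarOrderedRing M]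
  {d : ℕ} {τ : NSFTrace M}

/-- For integrable `g`, the square `‖E_k g‖² = ⟨g, E_k g⟩` is bounded through the supremum of
`E_k g`, hence by the reciprocal of the volume of a cube. -/
theorem norm_sq_condExp_le_of_integrable (k : ℤ) {g : L2N d τ} (hg : Integrable g) :
    ‖condExp k g‖ ^ 2 ≤ (volume.real (cube (d := d) 1 k 0))⁻¹ * (∫ x, ‖g x‖) ^ 2 := by
  set V := volume.real (cube (d := d) 1 k 0) with hV
  set I := ∫ x, ‖g x‖ with hI
  have hI0 : 0 ≤ I := integral_nonneg fun _ => norm_nonneg _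
  have hV0 : 0 ≤ V := measureReal_nonneg
  have hE : ∀ᵐ x, ‖condExp k g x‖ ≤ V⁻¹ * I := by
    filter_upwards [condExp_ae k g] with x hx
    have hVx : volume.real (cube 1 k (cubeIdx k x)) = V := by
      rw [hV, measureReal_def, measureReal_def, volume_cube_one, volume_cube_one]
    rw [hx, setAverage_eq, norm_smul, hVx, Real.norm_of_nonneg (inv_nonneg.2 hV0)]
    gcongr
    exact (norm_integral_le_integral_norm _).trans
      (setIntegral_le_integral hg.norm (ae_of_all _ fun _ => norm_nonneg _))
  have h1 : inner ℂ g (condExp k g) = inner ℂ (condExp k g) (condExp k g)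
      + inner ℂ (g - condExp k g) (condExp k g) := by
    rw [← inner_add_left, add_sub_cancel]
  have h2 : (inner ℂ (g - condExp k g) (condExp k g)).re = 0 := by
    rw [← inner_conj_symm, Complex.conj_re]
    exact re_inner_sub_eq_zero_of_contraction (P := condExpL k) (norm_condExp_le (τ := τ) k)
      (fun x => condExp_condExp_of_le le_rfl x) g
  have h3 : ‖condExp k g‖ ^ 2 = (inner ℂ g (condExp k g)).re := by
    rw [h1, Complex.add_re, h2, add_zero]
    exact norm_sq_eq_re_inner (𝕜 := ℂ) _
  calc ‖condExp k g‖ ^ 2 ≤ ‖inner ℂ g (condExp k g)‖ := h3.trans_le (Complex.re_le_norm _)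
    _ ≤ ∫ x, ‖g x‖ * (V⁻¹ * I) := by
        rw [L2.inner_def]
        refine norm_integral_le_of_norm_le (hg.norm.mul_const _) ?_
        filter_upwards [hE] with x hx
        exact (norm_inner_le_norm _ _).trans (by gcongr)
    _ = V⁻¹ * I ^ 2 := by
        rw [integral_mul_const]
        ring

/-- In positive dimension, `E_k h` tends to zero as the side length `2⁻ᵏ` tends to infinity. -/
theorem tendsto_condExp_neg (hd : d ≠ 0) (h : L2N d τ) (j : ℤ) :
    Filter.Tendsto (fun n : ℕ => condExp (j - n) h) Filter.atTop (nhds 0) := by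
  rw [Metric.tendsto_atTop]
  intro ε hε
  obtain ⟨g, hgc, hgε, hgcont, hgL⟩ := (Lp.memLp h).exists_hasCompactSupport_eLpNorm_sub_le
    (ε := ENNReal.ofReal (ε / 2)) (by norm_num) (by simpa using hε)
  set G : L2N d τ := hgL.toLp g with hG
  have hGi : Integrable G :=
    (hgcont.integrable_of_hasCompactSupport hgc).congr hgL.coeFn_toLp.symm
  have hhG : ‖h - G‖ ≤ ε / 2 := by
    have e : eLpNorm (h - G : L2N d τ) 2 volume = eLpNorm ((h : Rd d → L2 τ) - g) 2 volume := by
      refine eLpNorm_congr_ae ((Lp.coeFn_sub h G).trans ?_)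
      filter_upwards [hgL.coeFn_toLp] with x hx
      simp only [Pi.sub_apply, hG, hx]
    rw [Lp.norm_def, e]
    exact ENNReal.toReal_le_of_le_ofReal (by positivity) hgε
  set I := ∫ x, ‖G x‖
  have hvol : ∀ n : ℕ, j ≤ n →
      (volume.real (cube (d := d) 1 (j - n) 0))⁻¹ ≤ (2 : ℝ) ^ (j - n) := by
    intro n hn
    rw [measureReal_def, volume_cube_one, ← ENNReal.ofReal_pow (by positivity),
      ENNReal.toReal_ofReal (by positivity), inv_le_comm₀ (by positivity) (by positivity),
      ← zpow_neg]
    exact le_self_pow₀ (one_le_zpow₀ (by norm_num) (by lia)) hd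
  have hlim : Filter.Tendsto (fun n : ℕ => (2 : ℝ) ^ (j - n) * I ^ 2) Filter.atTop (nhds 0) := by
    have e : (fun n : ℕ => (2 : ℝ) ^ (j - n) * I ^ 2)
        = fun n : ℕ => (2 : ℝ) ^ j * I ^ 2 * (1 / 2) ^ n := by
      funext n
      rw [zpow_sub₀ (by norm_num), zpow_natCast, one_div, inv_pow]
      ring
    rw [e]
    simpa using (tendsto_pow_atTop_nhds_zero_of_lt_one (r := (1 / 2 : ℝ)) (by norm_num)
      (by norm_num)).const_mul ((2 : ℝ) ^ j * I ^ 2)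
  obtain ⟨N, hN⟩ := Metric.tendsto_atTop.1 hlim ((ε / 2) ^ 2) (by positivity)
  refine ⟨max N j.toNat, fun n hn => ?_⟩
  have hn1 : N ≤ n := (le_max_left _ _).trans hn
  have hn2 : j.toNat ≤ n := (le_max_right _ _).trans hn
  have h1 := hN n hn1
  rw [dist_zero_right, Real.norm_of_nonneg (by positivity)] at h1
  have h2 : ‖condExp (j - n) G‖ < ε / 2 := by
    refine lt_of_pow_lt_pow_left₀ 2 (by positivity) (lt_of_le_of_lt ?_ h1)
    refine (norm_sq_condExp_le_of_integrable _ hGi).trans ?_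
    gcongr
    exact hvol n (by lia)
  have h3 : condExp (j - n) h = condExp (j - n) (h - G) + condExp (j - n) G := by
    rw [← condExpL_apply, ← condExpL_apply, ← condExpL_apply, ← map_add, sub_add_cancel]
  rw [dist_zero_right, h3]
  have h4 := (norm_condExp_le (j - n) (h - G)).trans hhG
  linarith [norm_add_le (condExp (j - n) (h - G)) (condExp (j - n) G)]

end Vanishing

/-! ### Localization -/

section ProjSup

variable {H : Type u} [NormedAddCommGroup H] [InnerProductSpace ℂ H] [CompleteSpace H]
  {ι : Sort*} (p : ι → H →L[ℂ] H)

theorem projSup_eq_self_iff {x : H} :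
    projSup p x = x ↔ x ∈ (⨆ i, (p i).range).topologicalClosure :=
  haveI : CompleteSpace (⨆ i, (p i).range).topologicalClosure :=
    (Submodule.isClosed_topologicalClosure _).completeSpace_coe
  Submodule.starProjection_eq_self_iff

theorem one_sub_projSup_apply_eq_zero_iff {x : H} :
    (1 - projSup p) x = 0 ↔ x ∈ (⨆ i, (p i).range).topologicalClosure := by
  rw [← projSup_eq_self_iff, sub_apply, sub_eq_zero]
  exact eq_comm

theorem isStarProjection_projSup : IsStarProjection (projSup p) :=
  haveI : CompleteSpace (⨆ i, (p i).range).topologicalClosure :=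
    (Submodule.isClosed_topologicalClosure _).completeSpace_coe
  isStarProjection_starProjection

theorem norm_one_sub_projSup_apply_le (x : H) : ‖(1 - projSup p) x‖ ≤ ‖x‖ := by
  have : CompleteSpace (⨆ i, (p i).range).topologicalClosure :=
    (Submodule.isClosed_topologicalClosure _).completeSpace_coe
  have h := norm_sq_eq_add_of_contraction (P := projSup p)
    (fun x => Submodule.norm_starProjection_apply_le _ x)
    (fun x => by
      rw [projSup_eq_self_iff]
      exact Submodule.starProjection_apply_mem _ _) x
  exact le_of_sq_le_sq (by
    simp only [sub_apply, one_apply_eq_self]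
    nlinarith [sq_nonneg ‖projSup p x‖]) (norm_nonneg _)

end ProjSup

section Averages

variable {α E G : Type*} [MeasurableSpace α] [NormedAddCommGroup E] [NormedAddCommGroup G]
  [NormedSpace ℝ E] [NormedSpace ℝ G] [CompleteSpace E] [CompleteSpace G] {μ : Measure α}
  {T : Set α}

theorem map_setAverage (L : E →+ G) (hL : Continuous L) {f : α → E} (hf : IntegrableOn f T μ) :
    L (⨍ y in T, f y ∂μ) = ⨍ y in T, L (f y) ∂μ := by
  rw [setAverage_eq, setAverage_eq]
  have h := (L.toRealLinearMap hL).integral_comp_comm hf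
  have h' : ∫ y in T, L (f y) ∂μ = L (∫ y in T, f y ∂μ) := h
  rw [h']
  exact (L.toRealLinearMap hL).map_smul _ _

end Averages

section Localization

variable {M : Type u} [CStarAlgebra M] [PartialOrder M] [StarOrderedRing M]
  {d : ℕ} {τ : NSFTrace M}

theorem lmul_lmul (a b : M) (x : L2 τ) : lmul τ a (lmul τ b x) = lmul τ (a * b) x := by
  refine UniformSpace.Completion.induction_on x
    (isClosed_eq (by fun_prop) (by fun_prop)) fun y => ?_
  simp only [lmul, ContinuousLinearMap.completion_apply_coe]
  congr 1
  refine Subtype.ext ?_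
  change a * (b * PreL2.val τ y) = a * b * PreL2.val τ y
  rw [mul_assoc]

/-- If `S x` meets the cube `Q` only for `x ∈ 5Q`, then averaging over `S x` maps the range of
`1_Q ⊗ a` to the range of `1_{5Q} ⊗ a`. -/
theorem mem_range_indTensor_of_average {a : M} (ha : IsIdempotentElem a) {l : ℤ} {m : Fin d → ℤ}
    {S : Rd d → Set (Rd d)} (hS : ∀ x, MeasurableSet (S x)) (hS' : ∀ x, volume (S x) ≠ ∞)
    (hSl : ∀ x y, y ∈ S x → y ∈ cube 1 l m → x ∈ cube 5 l m) {f g : L2N d τ}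
    (hf : f ∈ (indTensor τ (measurableSet_cube 1 l m) a).range)
    (hg : g =ᵐ[volume] fun x => ⨍ y in S x, f y) :
    g ∈ (indTensor τ (measurableSet_cube 5 l m) a).range := by
  obtain ⟨f₀, hf⟩ := hf
  change indTensor τ (measurableSet_cube 1 l m) a f₀ = f at hf
  have hfa : ∀ᵐ y, lmul τ a (f y) = f y ∧ (y ∉ cube 1 l m → f y = 0) := by
    filter_upwards [indTensor_ae τ (measurableSet_cube 1 l m) a f₀] with y hy
    rw [hf] at hy
    refine ⟨?_, fun hym => by rw [hy, Set.indicator_of_notMem hym]⟩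
    rw [hy]
    by_cases hym : y ∈ cube 1 l m
    · rw [Set.indicator_of_mem hym, lmul_lmul, ha.eq]
    · rw [Set.indicator_of_notMem hym, map_zero]
  refine ⟨g, Lp.ext ?_⟩
  refine (indTensor_ae τ (measurableSet_cube 5 l m) a g).trans ?_
  filter_upwards [hg] with x hx
  by_cases hxm : x ∈ cube 5 l m
  · rw [Set.indicator_of_mem hxm, hx]
    refine (map_setAverage (lmul τ a : L2 τ →+ L2 τ) (lmul τ a).continuous
      (integrableOn_of_memLp_two (Lp.memLp f) (hS' x))).trans ?_
    rw [setAverage_eq, setAverage_eq]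
    congr 1
    exact integral_congr_ae (ae_restrict_of_ae (hfa.mono fun y hy => hy.1))
  · rw [Set.indicator_of_notMem hxm, hx, setAverage_eq, setIntegral_congr_ae (g := fun _ => 0)
      (hS x) (hfa.mono fun y hy hyS => hy.2 fun hym => hxm (hSl x y hyS hym)), integral_zero,
      smul_zero]

theorem mem_cube_five_of_mem_ball {k l : ℤ} (hlk : l ≤ k) {m : Fin d → ℤ} {x y : Rd d}
    (hxy : y ∈ Metric.ball x ((2 : ℝ) ^ (-k))) (hy : y ∈ cube 1 l m) : x ∈ cube 5 l m := by
  intro i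
  have h1 : |y i - x i| < (2 : ℝ) ^ (-l) := by
    calc |y i - x i| = ‖(y - x) i‖ := rfl
      _ ≤ ‖y - x‖ := PiLp.norm_apply_le _ _
      _ < (2 : ℝ) ^ (-k) := by rwa [← dist_eq_norm]
      _ ≤ (2 : ℝ) ^ (-l) := zpow_le_zpow_right₀ (by norm_num) (by lia)
  rw [abs_lt] at h1
  have h2 := hy i
  constructor <;> linarith

theorem mem_cube_five_of_cubeIdx_eq {k l : ℤ} (hlk : l ≤ k) {m : Fin d → ℤ} {x y : Rd d}
    (hxy : cubeIdx k y = cubeIdx k x) (hy : y ∈ cube 1 l m) : x ∈ cube 5 l m := by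
  have hx : x ∈ cube 1 l m := by
    rw [mem_cube_one] at hy ⊢
    rw [← hy, cubeIdx_eq_of_le hlk hxy]
  intro i
  have h2 := hx i
  have : (0 : ℝ) < 2 ^ (-l) := by positivity
  constructor <;> linarith

variable {a : ℤ → (Fin d → ℤ) → M}

/-- An operator that maps the range of each `1_Q ⊗ a_Q`, with `Q` of side length `2⁻ˡ`, to the
range of `1_{5Q} ⊗ a_Q` maps the range of `⋁_Q a_Q 1_Q` to that of `⋁ 5A_k`. -/
theorem compl_projSup_apply_eq_zero (T : L2N d τ →L[ℂ] L2N d τ) {l : ℤ}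
    (hT : ∀ m, ∀ f ∈ (indTensor τ (measurableSet_cube 1 l m) (a l m)).range,
      T f ∈ (indTensor τ (measurableSet_cube 5 l m) (a l m)).range)
    {g : L2N d τ}
    (hg : (1 - cubeSup τ 1 l (a l)) g = 0) :
    (1 - projSup fun k => cubeSup τ 5 k (a k)) (T g) = 0 := by
  rw [one_sub_projSup_apply_eq_zero_iff]
  set K := (⨆ k, (cubeSup τ 5 k (a k)).range).topologicalClosure with hK
  have hKc : IsClosed (K : Set (L2N d τ)) := Submodule.isClosed_topologicalClosure _
  rw [cubeSup, one_sub_projSup_apply_eq_zero_iff] at hg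
  have : (⨆ m, (indTensor τ (measurableSet_cube 1 l m) (a l m)).range).topologicalClosure ≤
      K.comap (T : L2N d τ →ₗ[ℂ] L2N d τ) := by
    refine Submodule.topologicalClosure_minimal _ (iSup_le fun m f hf => ?_)
      (hKc.preimage T.continuous)
    have h1 : (indTensor τ (measurableSet_cube 5 l m) (a l m)).range ≤
        (cubeSup τ 5 l (a l)).range := by
      intro x hx
      refine ⟨x, (projSup_eq_self_iff _).2 (Submodule.le_topologicalClosure _ ?_)⟩
      exact Submodule.mem_iSup_of_mem m hx
    exact Submodule.le_topologicalClosure _ (Submodule.mem_iSup_of_mem l (h1 (hT m f hf)))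
  exact this hg

theorem compl_projSup_ballAvg_eq_zero (ha : ∀ k m, IsStarProjection (a k m)) {k l : ℤ} (hlk : l ≤ k)
    {g : L2N d τ}
    (hg : (1 - cubeSup τ 1 l (a l)) g = 0) :
    (1 - projSup fun k => cubeSup τ 5 k (a k)) (ballAvg k g) = 0 :=
  compl_projSup_apply_eq_zero (ballAvgL k) (fun m f hf =>
    mem_range_indTensor_of_average (ha l m).isIdempotentElem (fun _ => measurableSet_ball)
      (fun _ => measure_ball_lt_top.ne) (fun _ _ => mem_cube_five_of_mem_ball hlk) hf
      (ballAvg_ae k f)) hg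

theorem compl_projSup_condExp_eq_zero (ha : ∀ k m, IsStarProjection (a k m)) {k l : ℤ} (hlk : l ≤ k)
    {g : L2N d τ}
    (hg : (1 - cubeSup τ 1 l (a l)) g = 0) :
    (1 - projSup fun k => cubeSup τ 5 k (a k)) (condExp k g) = 0 :=
  compl_projSup_apply_eq_zero (condExpL k) (fun m f hf =>
    mem_range_indTensor_of_average (ha l m).isIdempotentElem (fun _ => measurableSet_cube 1 k _)
      (fun _ => volume_cube_ne_top k _)
      (fun _ y hy => mem_cube_five_of_cubeIdx_eq hlk ((mem_cube_one k _ y).1 hy)) hf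
      (condExp_ae k f)) hg

theorem condExp_eq_add_sum_mdiff (j : ℤ) (n : ℕ) (h : L2N d τ) :
    condExp j h = condExp (j - n) h + ∑ i ∈ Finset.range n, mdiff (j - i) h := by
  induction n with
  | zero => simp
  | succ n ih =>
    rw [ih, Finset.sum_range_succ, mdiff]
    push_cast
    rw [sub_sub (j : ℤ) (n : ℤ) 1]
    abel

/-- An operator that annihilates the images of `dh_i`, for all `i ≤ j`, under `M_k` and `E_k`
annihilates that of `E_j h` under `M_k - E_k`, since `E_j h = ∑_{i ≤ j} dh_i`. -/
theorem map_ballAvg_sub_condExp_eq (hd : d ≠ 0) {h : L2N d τ} {k j : ℤ} (hkj : k ≤ j)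
    (P : L2N d τ →L[ℂ] L2N d τ) (hM : ∀ i : ℕ, P (ballAvg k (mdiff (j - i) h)) = 0)
    (hE : ∀ i : ℕ, P (condExp k (mdiff (j - i) h)) = 0) :
    P (ballAvg k h - condExp k h) = P (ballAvg k (h - condExp j h)) := by
  obtain ⟨D, hD⟩ : ∃ D : L2N d τ →L[ℂ] L2N d τ, ∀ f, D f = P (ballAvg k f) - P (condExp k f) :=
    ⟨P.comp (ballAvgL k) - P.comp (condExpL k), fun _ => rfl⟩
  have hD0 : D (condExp j h) = 0 := by
    -- `D` annihilates all the differences `E_j h - E_{j-n} h`, and `E_{j-n} h → 0`.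
    have h1 : ∀ n : ℕ, D (condExp (j - n) h) = D (condExp j h) := by
      intro n
      rw [condExp_eq_add_sum_mdiff j n, map_add, map_sum,
        Finset.sum_eq_zero fun i _ => by rw [hD, hM, hE, sub_zero], add_zero]
    have h2 := (D.continuous.tendsto 0).comp (tendsto_condExp_neg hd h j)
    rw [map_zero] at h2
    simp only [Function.comp_def, h1] at h2
    exact tendsto_nhds_unique tendsto_const_nhds h2
  have h4 : condExp k (h - condExp j h) = 0 := by
    rw [← condExpL_apply, map_sub, condExpL_apply, condExpL_apply,
      condExp_condExp_of_le hkj, sub_self]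
  have h3 : D h = D (h - condExp j h) := by rw [map_sub, hD0, sub_zero]
  rw [hD, hD, h4, map_zero, sub_zero] at h3
  rw [map_sub, h3]

/-- Off the dilated supports, `M_k - E_k` does not see the martingale differences of generation at
most `k + s`. -/
theorem compl_projSup_sub_eq (ha : ∀ k m, IsStarProjection (a k m)) (hd : d ≠ 0) {s : ℕ}
    {h : L2N d τ} (hA : ∀ k : ℤ, (1 - cubeSup τ 1 k (a k)) (mdiff (k + s) h) = 0) (k : ℤ) :
    (1 - projSup fun k => cubeSup τ 5 k (a k)) (ballAvg k h - condExp k h) =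
      (1 - projSup fun k => cubeSup τ 5 k (a k)) (ballAvg k (h - condExp (k + s) h)) := by
  have hA' : ∀ i : ℕ, (1 - cubeSup τ 1 (k - i) (a (k - i))) (mdiff (k + s - i) h) = 0 := by
    intro i
    have := hA (k - i)
    rwa [show k - (i : ℤ) + s = k + s - i by ring] at this
  exact map_ballAvg_sub_condExp_eq hd (by lia) _
    (fun i => compl_projSup_ballAvg_eq_zero ha (by lia) (hA' i))
    (fun i => compl_projSup_condExp_eq_zero ha (by lia) (hA' i))

end Localization

/-! ### Square functions and random signs -/

section SquareFunction

variable {M : Type u} [CStarAlgebra M] [PartialOrder M] [StarOrderedRing M]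
  {d : ℕ} {τ : NSFTrace M}

theorem sub_condExp_eq_sum_mdiff_add (j : ℤ) (N : ℕ) (h : L2N d τ) :
    h - condExp j h =
      ∑ i ∈ Finset.range N, mdiff (j + i + 1) h + (h - condExp (j + N) h) := by
  induction N with
  | zero => simp
  | succ N ih =>
    rw [ih, Finset.sum_range_succ, mdiff, add_sub_cancel_right]
    push_cast
    rw [← add_assoc (j : ℤ) (N : ℤ) 1]
    abel

theorem sum_norm_sq_mdiff_add_le (F : Finset ℤ) (t : ℤ) (h : L2N d τ) :
    ∑ k ∈ F, ‖mdiff (k + t) h‖ ^ 2 ≤ ‖h‖ ^ 2 := by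
  have := sum_norm_sq_mdiff_le (F.map (addRightEmbedding t)) h
  rwa [Finset.sum_map] at this

/-- The truncation at `N` leaves a remainder `h - E_{k+s+N} h` with mean zero on small cubes, so
that the convergence of `E_j h` to `h` for `j → ∞` plays no role. -/
theorem norm_ballAvg_sub_condExp_le (hd : d ≠ 0) (k : ℤ) (s N : ℕ) (h : L2N d τ) :
    ‖ballAvg k (h - condExp (k + s) h)‖ ≤
      d ^ 2 * (1 / 2) ^ s * (∑ i ∈ Finset.range N, (1 / 2) ^ i * ‖mdiff (k + s + i + 1) h‖
        + (1 / 2) ^ N * ‖h‖) := by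
  have pow_eq : ∀ i : ℕ, (2 : ℝ) ^ (k - (k + s + i)) = (1 / 2) ^ s * (1 / 2) ^ i := by
    intro i
    rw [show k - (k + s + i) = -((s + i : ℕ) : ℤ) by push_cast; ring, zpow_neg, zpow_natCast,
      ← pow_add, one_div, inv_pow]
  rw [sub_condExp_eq_sum_mdiff_add (k + s) N, ← ballAvgL_apply, map_add, map_sum, mul_add,
    Finset.mul_sum]
  refine (norm_add_le _ _).trans (add_le_add ((norm_sum_le _ _).trans ?_) ?_)
  · refine Finset.sum_le_sum fun i _ => ?_
    have h1 : condExp (k + s + i) (mdiff (k + s + i + 1) h) = 0 := by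
      have := condExp_mdiff (k + s + i + 1) h
      rwa [add_sub_cancel_right] at this
    refine (norm_ballAvg_le_of_condExp_eq_zero hd k h1).trans_eq ?_
    rw [pow_eq]
    ring
  · have h1 : condExp (k + s + N) (h - condExp (k + s + N) h) = 0 := by
      rw [← condExpL_apply, map_sub, condExpL_apply, condExpL_apply,
        condExp_condExp_of_le le_rfl, sub_self]
    refine (norm_ballAvg_le_of_condExp_eq_zero hd k h1).trans ?_
    rw [pow_eq, ← mul_assoc, ← mul_assoc]
    gcongr
    exact norm_sub_condExp_le _ _

/-- The quasi-orthogonality estimate: the contributions of `dh_{k+n}` decay geometrically in `n`,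
uniformly in `k`, and are summed by Cauchy-Schwarz. -/
theorem sum_norm_sq_ballAvg_le (hd : d ≠ 0) (F : Finset ℤ) (s : ℕ) (h : L2N d τ) :
    ∑ k ∈ F, ‖ballAvg k (h - condExp (k + s) h)‖ ^ 2 ≤ (3 * d ^ 2 * (1 / 2) ^ s * ‖h‖) ^ 2 := by
  set c : ℝ := d ^ 2 * (1 / 2) ^ s with hc
  have hc0 : 0 ≤ c := by positivity
  have bound : ∀ N : ℕ, ∑ k ∈ F, ‖ballAvg k (h - condExp (k + s) h)‖ ^ 2 ≤
      8 * (c * ‖h‖) ^ 2 + 2 * F.card * (c * ‖h‖) ^ 2 * ((1 / 2) ^ N) ^ 2 := by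
    intro N
    have hgeo : ∑ i ∈ Finset.range N, (1 / 2 : ℝ) ^ i ≤ 2 := sum_geometric_two_le N
    have each : ∀ k ∈ F, ‖ballAvg k (h - condExp (k + s) h)‖ ^ 2 ≤
        4 * c ^ 2 * ∑ i ∈ Finset.range N, (1 / 2) ^ i * ‖mdiff (k + (s + i + 1)) h‖ ^ 2
          + 2 * (c * ‖h‖) ^ 2 * ((1 / 2) ^ N) ^ 2 := by
      intro k _
      have h1 := pow_le_pow_left₀ (norm_nonneg _) (norm_ballAvg_sub_condExp_le hd k s N h) 2
      have h2 := Finset.sum_sq_le_sum_mul_sum_of_sq_le_mul (Finset.range N)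
        (r := fun i => (1 / 2 : ℝ) ^ i * ‖mdiff (k + s + i + 1) h‖)
        (f := fun i => (1 / 2 : ℝ) ^ i)
        (g := fun i => (1 / 2 : ℝ) ^ i * ‖mdiff (k + s + i + 1) h‖ ^ 2)
        (fun i _ => by positivity) (fun i _ => by positivity) (fun i _ => le_of_eq (by ring))
      have h3 : ∀ i : ℕ, k + ((s : ℤ) + i + 1) = k + s + i + 1 := fun i => by ring
      simp only [h3]
      set X := ∑ i ∈ Finset.range N, (1 / 2 : ℝ) ^ i * ‖mdiff (k + s + i + 1) h‖
      set Y := ∑ i ∈ Finset.range N, (1 / 2 : ℝ) ^ i * ‖mdiff (k + s + i + 1) h‖ ^ 2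
      have hY : 0 ≤ Y := Finset.sum_nonneg fun i _ => by positivity
      have h4 : X ^ 2 ≤ 2 * Y := h2.trans (by gcongr)
      have h5 : (X + (1 / 2) ^ N * ‖h‖) ^ 2 ≤ 4 * Y + 2 * ((1 / 2) ^ N * ‖h‖) ^ 2 := by
        nlinarith [sq_nonneg (X - (1 / 2) ^ N * ‖h‖)]
      calc _ ≤ c ^ 2 * (X + (1 / 2) ^ N * ‖h‖) ^ 2 := by rwa [mul_pow, ← hc] at h1
        _ ≤ c ^ 2 * (4 * Y + 2 * ((1 / 2) ^ N * ‖h‖) ^ 2) := by gcongr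
        _ = _ := by ring
    refine (Finset.sum_le_sum each).trans ?_
    rw [Finset.sum_add_distrib, Finset.sum_const, ← Finset.mul_sum, Finset.sum_comm]
    have h6 : ∑ i ∈ Finset.range N, ∑ k ∈ F,
        (1 / 2 : ℝ) ^ i * ‖mdiff (k + (s + i + 1)) h‖ ^ 2 ≤ 2 * ‖h‖ ^ 2 := by
      refine le_trans ?_ (mul_le_mul_of_nonneg_right hgeo (sq_nonneg ‖h‖))
      rw [Finset.sum_mul]
      refine Finset.sum_le_sum fun i _ => ?_
      rw [← Finset.mul_sum]
      gcongr
      exact sum_norm_sq_mdiff_add_le F _ h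
    have h7 := mul_le_mul_of_nonneg_left h6 (by positivity : 0 ≤ 4 * c ^ 2)
    rw [nsmul_eq_mul]
    linarith
  have hlim : Filter.Tendsto (fun N : ℕ => 8 * (c * ‖h‖) ^ 2
      + 2 * F.card * (c * ‖h‖) ^ 2 * ((1 / 2 : ℝ) ^ N) ^ 2) Filter.atTop
      (nhds (8 * (c * ‖h‖) ^ 2 + 2 * F.card * (c * ‖h‖) ^ 2 * 0 ^ 2)) :=
    ((((tendsto_pow_atTop_nhds_zero_of_lt_one (by norm_num) (by norm_num)).pow 2).const_mul
      _).const_add _)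
  refine (ge_of_tendsto' hlim bound).trans ?_
  have e : 3 * (d : ℝ) ^ 2 * (1 / 2) ^ s * ‖h‖ = 3 * (c * ‖h‖) := by rw [hc]; ring
  rw [e]
  nlinarith [sq_nonneg (c * ‖h‖)]

end SquareFunction

section Rademacher

variable {Ω : Type v} [MeasurableSpace Ω] {P : Measure Ω} [IsProbabilityMeasure P]
  {ε : ℤ → Ω → ℝ}

theorem IsRademacher.ae_eq (hε : IsRademacher ε P) (k : ℤ) :
    ∀ᵐ ω ∂P, ε k ω = 1 ∨ ε k ω = -1 := by
  have hm : ∀ c : ℝ, MeasurableSet {ω | ε k ω = c} := fun c =>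
    hε.measurable k (measurableSet_singleton c)
  have hdisj : Disjoint {ω | ε k ω = 1} {ω | ε k ω = -1} := by
    refine Set.disjoint_left.2 fun ω h1 h2 => ?_
    simp only [Set.mem_ofPred_eq] at h1 h2
    linarith
  have h1 : P ({ω | ε k ω = 1} ∪ {ω | ε k ω = -1}) = 1 := by
    rw [measure_union hdisj (hm _), hε.prob_one, hε.prob_neg_one, ENNReal.add_halves]
  exact (prob_compl_eq_zero_iff ((hm 1).union (hm (-1)))).2 h1

theorem IsRademacher.integral_eq_zero (hε : IsRademacher ε P) (k : ℤ) :
    ∫ ω, ε k ω ∂P = 0 := by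
  have hm : ∀ c : ℝ, MeasurableSet {ω | ε k ω = c} := fun c =>
    hε.measurable k (measurableSet_singleton c)
  have e : ε k =ᵐ[P] fun ω => {ω | ε k ω = 1}.indicator (fun _ => (1 : ℝ)) ω
      - {ω | ε k ω = -1}.indicator (fun _ => (1 : ℝ)) ω := by
    filter_upwards [hε.ae_eq k] with ω hω
    rcases hω with h | h <;> simp [Set.indicator, h] <;> norm_num
  rw [integral_congr_ae e, integral_sub ((integrable_const _).indicator (hm _))
    ((integrable_const _).indicator (hm _)), integral_indicator_const _ (hm _),
    integral_indicator_const _ (hm _), measureReal_def, measureReal_def, hε.prob_one,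
    hε.prob_neg_one, sub_self]

theorem IsRademacher.integrable_mul (hε : IsRademacher ε P) (k l : ℤ) :
    Integrable (fun ω => ε k ω * ε l ω) P := by
  refine Integrable.of_bound
    ((hε.measurable k).mul (hε.measurable l)).aestronglyMeasurable 1 ?_
  filter_upwards [hε.ae_eq k, hε.ae_eq l] with ω hk hl
  rcases hk with h | h <;> rcases hl with h' | h' <;> simp [h, h']

theorem IsRademacher.integral_mul (hε : IsRademacher ε P) (k l : ℤ) :
    ∫ ω, ε k ω * ε l ω ∂P = if k = l then 1 else 0 := by
  split_ifs with hkl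
  · subst hkl
    have e : (fun ω => ε k ω * ε k ω) =ᵐ[P] fun _ => 1 := by
      filter_upwards [hε.ae_eq k] with ω hω
      rcases hω with h | h <;> simp [h]
    rw [integral_congr_ae e]
    simp
  · rw [(hε.indep.indepFun hkl).integral_fun_mul_eq_mul_integral
      (hε.measurable k).aestronglyMeasurable (hε.measurable l).aestronglyMeasurable,
      hε.integral_eq_zero, zero_mul]

/-- Random signs are orthonormal in `L₂(Ω)`. -/
theorem IsRademacher.eLpNorm_sum_smul (hε : IsRademacher ε P) {H : Type*} [NormedAddCommGroup H]
    [InnerProductSpace ℂ H] (F : Finset ℤ) (w : ℤ → H) :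
    eLpNorm (fun ω => ∑ k ∈ F, (ε k ω : ℂ) • w k) 2 P =
      ENNReal.ofReal (Real.sqrt (∑ k ∈ F, ‖w k‖ ^ 2)) := by
  have expand : ∀ ω, ‖∑ k ∈ F, (ε k ω : ℂ) • w k‖ ^ 2 =
      ∑ k ∈ F, ∑ l ∈ F, ε k ω * ε l ω * (inner ℂ (w k) (w l)).re := by
    intro ω
    rw [norm_sq_eq_re_inner (𝕜 := ℂ), sum_inner, RCLike.re_to_complex, Complex.re_sum]
    refine Finset.sum_congr rfl fun k _ => ?_
    rw [inner_sum, Complex.re_sum]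
    refine Finset.sum_congr rfl fun l _ => ?_
    rw [inner_smul_left, inner_smul_right, Complex.conj_ofReal, ← mul_assoc,
      ← Complex.ofReal_mul, Complex.re_ofReal_mul]
  have hint : Integrable (fun ω => ‖∑ k ∈ F, (ε k ω : ℂ) • w k‖ ^ 2) P := by
    simp only [expand]
    exact integrable_finsetSum _ fun k _ => integrable_finsetSum _ fun l _ =>
      (hε.integrable_mul k l).mul_const _
  have hval : ∫ ω, ‖∑ k ∈ F, (ε k ω : ℂ) • w k‖ ^ 2 ∂P = ∑ k ∈ F, ‖w k‖ ^ 2 := by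
    simp only [expand]
    rw [integral_finsetSum _ fun k _ => integrable_finsetSum _ fun l _ =>
      (hε.integrable_mul k l).mul_const _]
    refine Finset.sum_congr rfl fun k hk => ?_
    rw [integral_finsetSum _ fun l _ => (hε.integrable_mul k l).mul_const _]
    simp only [integral_mul_const, hε.integral_mul, ite_mul, one_mul, zero_mul]
    rw [Finset.sum_ite_eq, if_pos hk, norm_sq_eq_re_inner (𝕜 := ℂ) (w k), RCLike.re_to_complex]
  rw [eLpNorm_eq_lintegral_rpow_enorm_toReal (by norm_num) (by norm_num), ENNReal.toReal_ofNat]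
  have e : ∫⁻ ω, ‖∑ k ∈ F, (ε k ω : ℂ) • w k‖ₑ ^ (2 : ℝ) ∂P =
      ENNReal.ofReal (∑ k ∈ F, ‖w k‖ ^ 2) := by
    rw [← hval, ofReal_integral_eq_lintegral_ofReal hint (ae_of_all _ fun _ => by positivity)]
    refine lintegral_congr fun ω => ?_
    rw [ENNReal.rpow_two, ENNReal.ofReal_pow (norm_nonneg _), ofReal_norm]
  rw [e, ENNReal.ofReal_rpow_of_nonneg (Finset.sum_nonneg fun _ _ => by positivity) (by norm_num),
    Real.sqrt_eq_rpow]

end Rademacher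

/-! ### The involution -/

section Star

variable {M : Type u} [CStarAlgebra M] [PartialOrder M] [StarOrderedRing M]
  {d : ℕ} {τ : NSFTrace M}

theorem starL2_starL2 (x : L2 τ) : starL2 τ (starL2 τ x) = x := by
  refine UniformSpace.Completion.induction_on x
    (isClosed_eq (by fun_prop) (by fun_prop)) fun y => ?_
  simp only [starL2, ContinuousLinearMap.completion_apply_coe]
  congr 1
  exact Subtype.ext (star_star (PreL2.val τ y))

theorem norm_starL2 (x : L2 τ) : ‖starL2 τ x‖ = ‖x‖ := by
  refine UniformSpace.Completion.induction_on x
    (isClosed_eq (by fun_prop) (by fun_prop)) fun y => ?_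
  rw [starL2, ContinuousLinearMap.completion_apply_coe, UniformSpace.Completion.norm_coe,
    UniformSpace.Completion.norm_coe, PreL2.norm_def, PreL2.norm_def]
  exact congrArg (fun t : ℝ≥0∞ => Real.sqrt t.toReal) (τ.sq_star (PreL2.val τ y))

theorem starN_ae (h : L2N d τ) : starN τ h =ᵐ[volume] fun x => starL2 τ (h x) :=
  (starL2 τ).coeFn_compLpL h

theorem starN_starN (h : L2N d τ) : starN τ (starN τ h) = h := by
  refine Lp.ext ?_
  filter_upwards [starN_ae (starN τ h), starN_ae h] with x h1 h2
  rw [h1, h2, starL2_starL2]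

theorem norm_starN (h : L2N d τ) : ‖starN τ h‖ = ‖h‖ := by
  rw [Lp.norm_def, Lp.norm_def]
  congr 1
  refine eLpNorm_congr_norm_ae ?_
  filter_upwards [starN_ae h] with x hx
  rw [hx, norm_starL2]

theorem starL2_setAverage {T : Set (Rd d)} (hT : volume T ≠ ∞) (h : L2N d τ) :
    starL2 τ (⨍ y in T, h y) = ⨍ y in T, starN τ h y := by
  refine (map_setAverage (starL2 τ : L2 τ →+ L2 τ) (starL2 τ).continuous
    (integrableOn_of_memLp_two (Lp.memLp h) hT)).trans ?_
  rw [setAverage_eq, setAverage_eq]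
  congr 1
  exact (integral_congr_ae (ae_restrict_of_ae (starN_ae h))).symm

theorem starN_ballAvg (k : ℤ) (h : L2N d τ) : starN τ (ballAvg k h) = ballAvg k (starN τ h) := by
  refine Lp.ext ?_
  filter_upwards [starN_ae (ballAvg k h), ballAvg_ae k h, ballAvg_ae k (starN τ h)]
    with x h1 h2 h3
  rw [h1, h2, h3, starL2_setAverage measure_ball_lt_top.ne]

theorem starN_condExp (k : ℤ) (h : L2N d τ) : starN τ (condExp k h) = condExp k (starN τ h) := by
  refine Lp.ext ?_
  filter_upwards [starN_ae (condExp k h), condExp_ae k h, condExp_ae k (starN τ h)]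
    with x h1 h2 h3
  rw [h1, h2, h3, starL2_setAverage (volume_cube_ne_top _ _)]

theorem starN_mdiff (k : ℤ) (h : L2N d τ) : starN τ (mdiff k h) = mdiff k (starN τ h) := by
  rw [mdiff, map_sub, starN_condExp, starN_condExp, mdiff]

theorem starN_radT {Ω : Type*} (ε : ℤ → Ω → ℝ) (F : Finset ℤ) (h : L2N d τ) (ω : Ω) :
    starN τ (radT ε F h ω) = radT ε F (starN τ h) ω := by
  rw [radT, radT, map_sum]
  refine Finset.sum_congr rfl fun k _ => ?_
  rw [ContinuousLinearMap.map_smulₛₗ, map_sub, starN_ballAvg, starN_condExp, Complex.conj_ofReal]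

theorem rightMul_one_sub {p : L2N d τ →L[ℂ] L2N d τ} (hp : IsStarProjection p) (h : L2N d τ) :
    rightMul τ (1 - p) h = starN τ ((1 - p) (starN τ h)) := by
  rw [rightMul, star_sub, star_one, hp.isSelfAdjoint.star_eq]

end Star

/-! ### Pseudo-localization -/

section Main

variable {M : Type u} [CStarAlgebra M] [PartialOrder M] [StarOrderedRing M]
  {d : ℕ} {τ : NSFTrace M}

/-- In dimension zero `E_k h = h` does not vanish as `k → -∞`, but all averages coincide. -/
theorem ballAvg_eq_condExp_of_dim_eq_zero (hd : d = 0) (k : ℤ) (h : L2N d τ) :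
    ballAvg k h = condExp k h := by
  subst hd
  have hr : (0 : ℝ) < 2 ^ (-k) := by positivity
  refine Lp.ext ?_
  filter_upwards [ballAvg_ae k h, condExp_ae k h] with x h1 h2
  have e : Metric.ball x ((2 : ℝ) ^ (-k)) = cube 1 k (cubeIdx k x) := by
    ext y
    obtain rfl : y = x := Subsingleton.elim _ _
    simp only [Metric.mem_ball_self hr, mem_cube_one]
  rw [h1, h2, e]

/-- The pseudo-localization estimate for the multiplication from the left. -/
theorem eLpNorm_compl_projSup_radT_le {Ω : Type v} [MeasurableSpace Ω] {P : Measure Ω}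
    [IsProbabilityMeasure P] {ε : ℤ → Ω → ℝ} (hε : IsRademacher ε P) (F : Finset ℤ)
    {a : ℤ → (Fin d → ℤ) → M} (ha : ∀ k m, IsStarProjection (a k m)) {s : ℕ} {h : L2N d τ}
    (hA : ∀ k : ℤ, (1 - cubeSup τ 1 k (a k)) (mdiff (k + s) h) = 0) :
    eLpNorm (fun ω => (1 - projSup fun k => cubeSup τ 5 k (a k)) (radT ε F h ω)) 2 P ≤
      ENNReal.ofReal ((3 * d ^ 2 + 1) * (2 : ℝ) ^ (-(s : ℝ) / 2) * ‖h‖) := by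
  simp only [radT, map_sum, map_smul]
  rw [hε.eLpNorm_sum_smul]
  refine ENNReal.ofReal_le_ofReal (Real.sqrt_le_iff.2 ⟨by positivity, ?_⟩)
  rcases eq_or_ne d 0 with hd | hd
  · simp only [ballAvg_eq_condExp_of_dim_eq_zero hd, sub_self, map_zero, norm_zero]
    simp only [ne_eq, OfNat.ofNat_ne_zero, not_false_eq_true, zero_pow, Finset.sum_const_zero]
    positivity
  have hs : (1 / 2 : ℝ) ^ s ≤ (2 : ℝ) ^ (-(s : ℝ) / 2) := by
    rw [one_div, inv_pow, ← Real.rpow_natCast, ← Real.rpow_neg (by norm_num)]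
    have : (0 : ℝ) ≤ s := s.cast_nonneg
    exact Real.rpow_le_rpow_of_exponent_le (by norm_num) (by linarith)
  calc ∑ k ∈ F, ‖(1 - projSup fun k => cubeSup τ 5 k (a k)) (ballAvg k h - condExp k h)‖ ^ 2
      ≤ ∑ k ∈ F, ‖ballAvg k (h - condExp (k + s) h)‖ ^ 2 := by
        refine Finset.sum_le_sum fun k _ => pow_le_pow_left₀ (norm_nonneg _) ?_ 2
        rw [compl_projSup_sub_eq ha hd hA]
        exact norm_one_sub_projSup_apply_le _ _
    _ ≤ (3 * d ^ 2 * (1 / 2) ^ s * ‖h‖) ^ 2 := sum_norm_sq_ballAvg_le hd F s h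
    _ ≤ ((3 * d ^ 2 + 1) * (2 : ℝ) ^ (-(s : ℝ) / 2) * ‖h‖) ^ 2 := by
        gcongr
        linarith

end Main

end PseudoLoc

end

theorem theorem3p9 (d : ℕ) :
    ∃ C : ℝ, 0 < C ∧
      ∀ (M : Type u) [CStarAlgebra M] [WStarAlgebra M] [PartialOrder M] [StarOrderedRing M]
        (τ : PseudoLoc.NSFTrace M)
        (Ω : Type v) [MeasurableSpace Ω] (P : Measure Ω) [IsProbabilityMeasure P]
        (ε : ℤ → Ω → ℝ), PseudoLoc.IsRademacher ε P →
      ∀ (F : Finset ℤ) (h : PseudoLoc.L2N d τ) (s : ℕ), 1 ≤ s →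
      ∀ (A B : ℤ → PseudoLoc.L2N d τ →L[ℂ] PseudoLoc.L2N d τ) (a b : ℤ → (Fin d → ℤ) → M),
        (∀ k, A k ∈ PseudoLoc.algNk d τ k ∧ IsStarProjection (A k)) →
        (∀ k, B k ∈ PseudoLoc.algNk d τ k ∧ IsStarProjection (B k)) →
        (∀ k m, IsStarProjection (a k m)) →
        (∀ k m, IsStarProjection (b k m)) →
        (∀ k, A k = PseudoLoc.cubeSup τ 1 k (a k)) →
        (∀ k, B k = PseudoLoc.cubeSup τ 1 k (b k)) →
        (∀ k : ℤ, (1 - A k) (PseudoLoc.mdiff (k + s) h) = 0) →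
        (∀ k : ℤ, PseudoLoc.rightMul τ (1 - B k) (PseudoLoc.mdiff (k + s) h) = 0) →
        eLpNorm (fun ω => (1 - PseudoLoc.projSup fun k => PseudoLoc.cubeSup τ 5 k (a k))
            (PseudoLoc.radT ε F h ω)) 2 P
          ≤ ENNReal.ofReal (C * (2 : ℝ) ^ (-(s : ℝ) / 2) * ‖h‖) ∧
        eLpNorm (fun ω => PseudoLoc.rightMul τ
            (1 - PseudoLoc.projSup fun k => PseudoLoc.cubeSup τ 5 k (b k))
            (PseudoLoc.radT ε F h ω)) 2 P
          ≤ ENNReal.ofReal (C * (2 : ℝ) ^ (-(s : ℝ) / 2) * ‖h‖) := by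
  refine ⟨3 * d ^ 2 + 1, by positivity, ?_⟩
  intro M _ _ _ _ τ Ω _ P _ ε hε F h s _ A B a b _ hB ha hb hAa hBb hA0 hB0
  refine ⟨PseudoLoc.eLpNorm_compl_projSup_radT_le hε F ha fun k => ?_, ?_⟩
  · rw [← hAa]
    exact hA0 k
  -- The bound for the right multiplication is the bound for the left one, applied to `h^*`.
  · have hB1 : ∀ k : ℤ, (1 - PseudoLoc.cubeSup τ 1 k (b k))
        (PseudoLoc.mdiff (k + s) (PseudoLoc.starN τ h)) = 0 := by
      intro k
      have h1 := hB0 k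
      rw [PseudoLoc.rightMul_one_sub (hB k).2, PseudoLoc.starN_mdiff] at h1
      rw [← hBb, ← PseudoLoc.starN_starN ((1 - B k) _), h1, map_zero]
    have h2 := PseudoLoc.eLpNorm_compl_projSup_radT_le hε F hb hB1
    rw [PseudoLoc.norm_starN] at h2
    refine le_trans (le_of_eq (eLpNorm_congr_norm_ae (ae_of_all _ fun ω => ?_))) h2
    rw [PseudoLoc.rightMul_one_sub (PseudoLoc.isStarProjection_projSup _), PseudoLoc.norm_starN,
      PseudoLoc.starN_radT]
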